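/- **Setting.** Let $n=m+p$ with $m,p\ge 0$. Consider an autonomous analytic control system $\dot x_i=f_i(x,\dot x_1,\dots,\dot x_m)$, $m<i\le n$. Let $V$ be the associated diffiety: a connected open subset of the space with coordinates $x_i^{(k)}$ ($1\le i\le m$, $k\ge0$) and $x_i$ ($m<i\le n$), with the product topology, on which the $f_i$ are analytic. Its functions $\mathcal O(V)$ are the analytic functions of finitely many coordinates, and its Cartan field is $\tau=\sum_{i\le m}\sum_{k\ge0}x_i^{(k+1)}\partial_{x_i^{(k)}}+\sum_{i>m}f_i\,\partial_{x_i}$. Let $\delta$ be an infinitesimal symmetry of $V$, i.e. a vector field with coefficients in $\mathcal O(V)$ such that $\delta\tau=\tau\delta$, and put $a_i=\delta x_i$. Let $\mathrm{ord}_\tau F$ be the largest $k$ such that $F$ actually depends on some coordinate that is a $k$-th $\tau$-derivative of an $x_i$. The symmetry $\delta$ is called *integrable* if the orders $\mathrm{ord}_\tau\,\delta^\ell x_i$ ($1\le i\le n$) and $\mathrm{ord}_\tau\,\delta^\ell\dot x_k$ ($1\le k\le m$), $\ell\ge 0$, are bounded. Let $\Upsilon=\{\tau^a\delta^b x_i :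 1\le i\le n,\ a,b\ge 0\}$ be the set of derivatives, regarded as independent coordinates with the two derivations $\tau,\delta$. Fix a point $v\in V$ and let $\eta\in\mathbb R^\Upsilon$ be the point whose coordinates are the values at $v$ of the functions $\tau^a\delta^b x_i\in\mathcal O(V)$. In the ring of germs at $\eta$ of analytic functions of finitely many derivatives, let $\mathcal I$ be the differential ideal generated by $\delta x_i-a_i$ ($1\le i\le n$) and $\tau x_i-f_i$ ($m<i\le n$); it defines the partial diffiety $V_{\tau,\delta}$ near $\eta$. An *admissible ordering* is a strict total order $\prec$ on $\Upsilon$ such that, for $\theta\in\{\tau,\delta\}$, one has $\upsilon\prec\theta\upsilon$, and $\theta\upsilon_1\prec\theta\upsilon_2\Leftrightarrow\upsilon_1\prec\upsilon_2$. It is a *$\delta$-ordering* if, for each $i$, $\tau^{a_1}\delta^{b_1}x_i\prec\tau^{a_2}\delta^{b_2}x_i$ whenever $a_1<a_2$, or $a_1=a_2$ and $b_1<b_2$. The *main derivative* $\upsilon_P$ of a nonconstant germ $P$ is the largest derivative on which it depends. Writing $P=\sum_k c_k(\upsilon_P-\eta_{\upsilon_P})^k$ with $c_k$ not depending on $\upsilon_P$,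 its *degree* $d_P$ is the smallest $k$ with $c_k\ne0$, its *initial* is $I_P=c_{d_P}$ and its *rank* is $(\upsilon_P,d_P)$; ranks are compared lexicographically. A *chain* of $\mathcal I$ is a finite set of nonconstant $A\in\mathcal I$ with $I_A\notin\mathcal I$, such that no $\upsilon_A$ is equal to or a derivative of $\upsilon_{A'}$ for $A\neq A'$ in the chain. Chains, enumerated increasingly, are compared lexicographically by their sequences of ranks, a proper continuation of a chain being smaller than it. A *characteristic set* of $\mathcal I$ is a chain of minimal rank. Let $\mathcal A$ be a characteristic set of $\mathcal I$ at $\eta$ for an admissible ordering $\prec$, and assume, as holds at suitable points, that every $A\in\mathcal A$ has the form $\upsilon_A-R_A$ with $R_A$ not depending on $\upsilon_A$. For each $i$ let $\alpha_i$ (resp. $\beta_i$) be the smallest $a$ (resp. $b$) such that some $\tau^a\delta^bx_i$ is a main derivative of an element of $\mathcal A$ ($\infty$ if there is none). The *tunnel number* is $\sum_{i=1}^n\alpha_i$ and the *chimney number* is $\sum_{i=1}^n\beta_i$. **Theorem.** (i) For any admissible ordering $\prec$, the chimney number is at most $m$. (ii) If $\prec$ is a $\delta$-ordering, the following are equivalent: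 (a) $\delta$ is integrable; (b) the tunnel number is $0$; (c) the chimney number is equal to $m$. -/

import Mathlib

open Filter Topology

noncomputable section

namespace Diff

/-! ### Analytic functions of finitely many among infinitely many coordinates -/

section Functions

variable {κ : Type*}

/-- Near `z`, the function `F` on `ℝ^κ` (product topology) is an analytic function of the
coordinates in the finite set `S`. -/
def AnalyticNear (S : Finset κ) (F : (κ → ℝ) → ℝ) (z : κ → ℝ) : Prop :=
  ∃ g : (S → ℝ) → ℝ, AnalyticAt ℝ g (fun s => z s) ∧
    F =ᶠ[𝓝 z] fun w => g (fun s => w s)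

/-- `F` belongs to `𝒪(U)`: it is analytic on `U` and depends on finitely many coordinates. -/
def IsFunctionOn (U : Set (κ → ℝ)) (F : (κ → ℝ) → ℝ) : Prop :=
  ∃ S : Finset κ, ∀ z ∈ U, AnalyticNear S F z

/-- `F` represents a germ at `η` of an analytic function of finitely many coordinates. -/
def IsGermAt (η : κ → ℝ) (F : (κ → ℝ) → ℝ) : Prop :=
  ∃ S : Finset κ, AnalyticNear S F η

/-- `F` and `G` represent the same germ at `η`. -/
def SameGerm (η : κ → ℝ) (F G : (κ → ℝ) → ℝ) : Prop := F =ᶠ[𝓝 η] G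

variable [DecidableEq κ]

/-- The partial derivative `∂F/∂c`. -/
def pderiv (c : κ) (F : (κ → ℝ) → ℝ) : (κ → ℝ) → ℝ :=
  fun z => deriv (fun s : ℝ => F (Function.update z c s)) (z c)

/-- The vector field `∑_c b_c ∂_c`, acting on functions of finitely many coordinates. -/
def vectorField (b : κ → (κ → ℝ) → ℝ) (F : (κ → ℝ) → ℝ) : (κ → ℝ) → ℝ :=
  fun z => ∑ᶠ c, b c z * pderiv c F z

end Functions

/-! ### The ordinary diffiety of a control system and its infinitesimal symmetries -/

/-- Indices of the functions `x_1, …, x_n`, where `n = m + p`: first the `m` functions whose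
first derivatives are the controls, then the `p` remaining ones. -/
abbrev Var (m p : ℕ) : Type := Fin m ⊕ Fin p

/-- Coordinates of the ordinary diffiety: `Sum.inl (i, k)` is `x_i^(k)` for one of the
first `m` indices, and `Sum.inr j` is one of the last `p` functions. -/
abbrev Coord (m p : ℕ) : Type := (Fin m × ℕ) ⊕ Fin p

namespace Coord

variable {m p : ℕ}

/-- The coordinate `x_i`. -/
def x : Var m p → Coord m p
  | Sum.inl i => Sum.inl (i, 0)
  | Sum.inr j => Sum.inr j

/-- The control `u_i = x_i'`. -/
def u (i : Fin m) : Coord m p := Sum.inl (i, 1)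

/-- The number of derivations by `τ` in a coordinate. -/
def order : Coord m p → ℕ
  | Sum.inl (_, k) => k
  | Sum.inr _ => 0

end Coord

variable {m p : ℕ}

/-- The order in `τ` of `F` on `U`: the highest order of a coordinate on which `F` actually
depends (`0` if there is none, `⊤` if these orders are unbounded). -/
def ordTau (U : Set (Coord m p → ℝ)) (F : (Coord m p → ℝ) → ℝ) : ℕ∞ :=
  ⨆ (c : Coord m p) (_ : ∃ z ∈ U, pderiv c F z ≠ 0), (c.order : ℕ∞)

/-- The diffiety of an autonomous control system `x_i' = f_i(x, x_1', …, x_m')`, `m < i ≤ n`,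
on a connected open set of its space of coordinates. -/
structure OrdDiffiety (m p : ℕ) where
  /-- the domain -/
  U : Set (Coord m p → ℝ)
  isOpen : IsOpen U
  isConnected : IsConnected U
  /-- the right-hand sides -/
  f : Fin p → (Coord m p → ℝ) → ℝ
  f_analytic : ∀ j, IsFunctionOn U (f j)
  f_order : ∀ j, ordTau U (f j) ≤ 1

namespace OrdDiffiety

variable (V : OrdDiffiety m p)

/-- Coefficients of the Cartan field. -/
def cartanCoeff : Coord m p → (Coord m p → ℝ) → ℝ
  | Sum.inl (i, k) => fun z => z (Sum.inl (i, k + 1))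
  | Sum.inr j => V.f j

/-- The Cartan field `τ`. -/
def tau : ((Coord m p → ℝ) → ℝ) → (Coord m p → ℝ) → ℝ := vectorField V.cartanCoeff

end OrdDiffiety

/-- An infinitesimal symmetry: a vector field with coefficients in `𝒪(U)` that commutes with
the Cartan field. -/
structure Symmetry (V : OrdDiffiety m p) where
  /-- the coefficients -/
  coeff : Coord m p → (Coord m p → ℝ) → ℝ
  coeff_analytic : ∀ c, IsFunctionOn V.U (coeff c)
  commutes : ∀ F, IsFunctionOn V.U F → ∀ z ∈ V.U,
    vectorField coeff (V.tau F) z = V.tau (vectorField coeff F) z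

namespace Symmetry

variable {V : OrdDiffiety m p} (D : Symmetry V)

/-- The derivation `δ`. -/
def delta : ((Coord m p → ℝ) → ℝ) → (Coord m p → ℝ) → ℝ := vectorField D.coeff

/-- `δ` is integrable: the orders in `τ` of all `δ^ℓ x_i` and `δ^ℓ u_k` are bounded. -/
def Integrable : Prop :=
  (⨆ (i : Var m p) (l : ℕ), ordTau V.U (D.delta^[l] (fun z => z (Coord.x i)))) ⊔
    (⨆ (k : Fin m) (l : ℕ), ordTau V.U (D.delta^[l] (fun z => z (Coord.u k)))) < ⊤

end Symmetry

/-! ### Derivatives in two derivations, admissible orderings -/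

/-- The derivative `τ^a δ^b x_i` is encoded as `(i, a, b)`. These are the coordinates of the
trivial diffiety with two derivations. -/
abbrev Der (m p : ℕ) : Type := Var m p × ℕ × ℕ

/-- `τ υ`. -/
def Der.tau (υ : Der m p) : Der m p := (υ.1, υ.2.1 + 1, υ.2.2)

/-- `δ υ`. -/
def Der.delta (υ : Der m p) : Der m p := (υ.1, υ.2.1, υ.2.2 + 1)

/-- `υ'` is equal to `υ` or is a derivative of `υ`. -/
def IsDerOf (υ' υ : Der m p) : Prop := ∃ a b : ℕ, υ' = Der.tau^[a] (Der.delta^[b] υ)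

/-- Admissible orderings `≺` on derivatives. -/
structure IsAdmissible (r : Der m p → Der m p → Prop) : Prop where
  total : IsStrictTotalOrder (Der m p) r
  lt_tau : ∀ υ, r υ υ.tau
  lt_delta : ∀ υ, r υ υ.delta
  tau_iff : ∀ υ₁ υ₂, r υ₁.tau υ₂.tau ↔ r υ₁ υ₂
  delta_iff : ∀ υ₁ υ₂, r υ₁.delta υ₂.delta ↔ r υ₁ υ₂

/-- A `δ`-ordering: an admissible ordering that, on the derivatives of each `x_i`, compares
first the number of derivations by `τ`, then the number of derivations by `δ`. -/
structure IsDeltaOrdering (r : Der m p → Der m p → Prop) : Prop where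
  admissible : IsAdmissible r
  lex : ∀ (i : Var m p) (a₁ b₁ a₂ b₂ : ℕ), a₁ < a₂ ∨ (a₁ = a₂ ∧ b₁ < b₂) →
    r (i, a₁, b₁) (i, a₂, b₂)

/-! ### The partial diffiety and its ideal -/

/-- The derivation `τ` of the trivial diffiety. -/
def tauT : ((Der m p → ℝ) → ℝ) → (Der m p → ℝ) → ℝ := vectorField fun υ z => z υ.tau

/-- The derivation `δ` of the trivial diffiety. -/
def deltaT : ((Der m p → ℝ) → ℝ) → (Der m p → ℝ) → ℝ := vectorField fun υ z => z υ.delta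

/-- The coordinates of the ordinary diffiety among the derivatives. -/
def Coord.toDer : Coord m p → Der m p
  | Sum.inl (i, k) => (Sum.inl i, k, 0)
  | Sum.inr j => (Sum.inr j, 0, 0)

/-- A function on the ordinary diffiety, seen as a function on the trivial diffiety. -/
def lift (F : (Coord m p → ℝ) → ℝ) : (Der m p → ℝ) → ℝ := fun z => F fun c => z c.toDer

/-- In the ring of germs at `η`, the differential ideal generated by the functions in `G`. -/
inductive InDiffIdeal (η : Der m p → ℝ) (G : Set ((Der m p → ℝ) → ℝ)) :
    ((Der m p → ℝ) → ℝ) → Prop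
  | gen (P) : P ∈ G → InDiffIdeal η G P
  | zero : InDiffIdeal η G 0
  | add (P Q) : InDiffIdeal η G P → InDiffIdeal η G Q → InDiffIdeal η G (P + Q)
  | mul (C P) : IsGermAt η C → InDiffIdeal η G P → InDiffIdeal η G (C * P)
  | tau (P) : InDiffIdeal η G P → InDiffIdeal η G (tauT P)
  | delta (P) : InDiffIdeal η G P → InDiffIdeal η G (deltaT P)
  | congr (P Q) : SameGerm η P Q → InDiffIdeal η G P → InDiffIdeal η G Q

namespace Symmetry

variable {V : OrdDiffiety m p} (D : Symmetry V)

/-- The equations `δ x_i - a_i = 0`, `1 ≤ i ≤ n`, and `τ x_i - f_i = 0`, `m < i ≤ n`. -/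
def equations : Set ((Der m p → ℝ) → ℝ) :=
  Set.range (fun (i : Var m p) (z : Der m p → ℝ) =>
      z (i, 0, 1) - lift (D.coeff (Coord.x i)) z) ∪
    Set.range (fun (j : Fin p) (z : Der m p → ℝ) => z (Sum.inr j, 1, 0) - lift (V.f j) z)

/-- The point of the partial diffiety corresponding to the point `v` of the ordinary diffiety:
its coordinate `τ^a δ^b x_i` is the value at `v` of the function `τ^a δ^b x_i`. -/
def point (v : Coord m p → ℝ) : Der m p → ℝ :=
  fun υ => V.tau^[υ.2.1] (D.delta^[υ.2.2] (fun z => z (Coord.x υ.1))) v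

/-- The ideal of the partial diffiety in the ring of germs at the point over `v`. -/
def InIdeal (v : Coord m p → ℝ) : ((Der m p → ℝ) → ℝ) → Prop :=
  InDiffIdeal (D.point v) D.equations

end Symmetry

/-! ### Ranks, chains, characteristic sets -/

section Chains

variable (η : Der m p → ℝ) (r : Der m p → Der m p → Prop)

/-- The germ of `P` at `η` depends on `υ`. -/
def DependsOn (P : (Der m p → ℝ) → ℝ) (υ : Der m p) : Prop := ¬ SameGerm η (pderiv υ P) 0

/-- `υ` is the main derivative of `P`. -/
def IsMain (P : (Der m p → ℝ) → ℝ) (υ : Der m p) : Prop :=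
  DependsOn η P υ ∧ ∀ υ', DependsOn η P υ' → υ' = υ ∨ r υ' υ

/-- The coefficient of `(υ - η_υ)^k` in the expansion of `P` as a power series in `υ - η_υ`. -/
def coeffAt (υ : Der m p) (k : ℕ) (P : (Der m p → ℝ) → ℝ) : (Der m p → ℝ) → ℝ :=
  fun z => (pderiv υ)^[k] P (Function.update z υ (η υ)) / (k.factorial : ℝ)

/-- The degree in `υ`: the smallest `k` such that the coefficient of `(υ - η_υ)^k` is not `0`. -/
def degreeIn (υ : Der m p) (P : (Der m p → ℝ) → ℝ) : ℕ :=
  sInf {k : ℕ | ¬ SameGerm η (coeffAt η υ k P) 0}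

/-- `P` has main derivative `ρ.1` and degree `ρ.2`. -/
def HasRank (P : (Der m p → ℝ) → ℝ) (ρ : Der m p × ℕ) : Prop :=
  IsMain η r P ρ.1 ∧ ρ.2 = degreeIn η ρ.1 P

/-- Comparison of ranks. -/
def RankLT (ρ₁ ρ₂ : Der m p × ℕ) : Prop := r ρ₁.1 ρ₂.1 ∨ (ρ₁.1 = ρ₂.1 ∧ ρ₁.2 < ρ₂.2)

/-- The list `A` is a chain of the ideal `I`, enumerated increasingly, with list of ranks `ρ`. -/
def IsChainOf (I : ((Der m p → ℝ) → ℝ) → Prop) (A : List ((Der m p → ℝ) → ℝ))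
    (ρ : List (Der m p × ℕ)) : Prop :=
  (∀ P ∈ A, I P) ∧
  List.Forall₂ (fun P s => HasRank η r P s ∧ ¬ I (coeffAt η s.1 s.2 P)) A ρ ∧
  ρ.Pairwise (fun s t => r s.1 t.1 ∧ ¬ IsDerOf t.1 s.1 ∧ ¬ IsDerOf s.1 t.1)

/-- Comparison of chains through their lists of ranks: lexicographic, and a chain is
smaller than its proper initial segments. -/
def RanksLT (ρ₁ ρ₂ : List (Der m p × ℕ)) : Prop :=
  (∃ (l t₁ t₂ : List (Der m p × ℕ)) (s₁ s₂ : Der m p × ℕ),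
    ρ₁ = l ++ s₁ :: t₁ ∧ ρ₂ = l ++ s₂ :: t₂ ∧ RankLT r s₁ s₂) ∨
  (ρ₂.length < ρ₁.length ∧ ρ₂ <+: ρ₁)

/-- A characteristic set of `I`: a chain of minimal rank. -/
def IsCharSet (I : ((Der m p → ℝ) → ℝ) → Prop) (A : List ((Der m p → ℝ) → ℝ)) : Prop :=
  ∃ ρ, IsChainOf η r I A ρ ∧ ∀ A' ρ', IsChainOf η r I A' ρ' → ¬ RanksLT r ρ' ρ

/-- Every element of `A` is of the form `υ - R`, where `υ` is its main derivative and the germ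
`R` does not depend on `υ`. -/
def IsSolved (A : List ((Der m p → ℝ) → ℝ)) : Prop :=
  ∀ P ∈ A, ∃ (υ : Der m p) (R : (Der m p → ℝ) → ℝ), IsMain η r P υ ∧ IsGermAt η R ∧
    ¬ DependsOn η R υ ∧ SameGerm η P (fun z => z υ - R z)

/-- The tunnel number: the sum over `i` of the smallest `a` such that some `τ^a δ^b x_i` is a
main derivative of `A` (`⊤` if there is none). -/
def tunnelNumber (A : List ((Der m p → ℝ) → ℝ)) : ℕ∞ :=
  ∑ i : Var m p, ⨅ (a : ℕ) (_ : ∃ P ∈ A, ∃ b, IsMain η r P (i, a, b)), (a : ℕ∞)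

/-- The chimney number: the sum over `i` of the smallest `b` such that some `τ^a δ^b x_i` is a
main derivative of `A` (`⊤` if there is none). -/
def chimneyNumber (A : List ((Der m p → ℝ) → ℝ)) : ℕ∞ :=
  ∑ i : Var m p, ⨅ (b : ℕ) (_ : ∃ P ∈ A, ∃ a, IsMain η r P (i, a, b)), (b : ℕ∞)

end Chains

end Diff

end

/-! Call a derivative parametric if it is neither a main derivative of the characteristic set nor a
derivative of one. The heart of the proof is that the functions `τ^a δ^b x_i` (`jet`) attached to
parametric derivatives form, near `v`, another system of coordinates on the ordinary diffiety; the
theorem follows by comparing it with the original coordinates, of which exactly `m(N+1)+p` have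
order at most `N`.

Two facts give these coordinates. Since the elements of the chain are solved for their main
derivatives, differentiating and substituting expresses every derivative, modulo the ideal, through
parametric derivatives that are not larger (`exists_reduction`). Since the chain has minimal rank,
the ideal contains no nonzero germ in parametric derivatives only: such a germ would allow a lower
chain (`eventuallyEq_zero_of_parametric`). As every derivative is also congruent to a function on
the ordinary diffiety (`sub_lift_jet_mem`), the differentials at `v` of the parametric jets are
linearly independent (`parametric_independent`).

Picture the derivatives of each `x_i` as the points `(a, b)` of a quadrant. For `b < β_i` the whole
half-line of varying `a` (a column) is parametric. As `τ` raises the order by at most one, `k ∑ β_i`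
independent functions have order at most `k + C`; comparing growth in `k` gives `∑ β_i ≤ m`. If
equality holds, the columns exhaust the dimension up to a bounded amount, so no row `δ^b x_i`, `b ≥
0`, can be wholly parametric: the tunnel number is `0`. Integrability excludes such a row too,
because infinitely many independent functions cannot have bounded order.

Conversely, let the tunnel number be `0`. The parametric derivatives outside finite columns then
form a finite set, and all coordinates of order at most `k` are functions of parametric derivatives
with `a ≤ k + C`; counting in the other direction gives `m ≤ ∑ β_i` (`le_sum_chimney`). For a
`δ`-ordering, every parametric derivative lies in a finite set of parametric derivatives whose
functions are stable under `δ` (`exists_delta_stable`); this bounds the orders of all `δ^ℓ x_i` and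
`δ^ℓ u_k` near `v`, and on the whole connected domain by the identity theorem. -/

noncomputable section

namespace Diff

/-! ### Differential calculus for functions of finitely many among infinitely many coordinates. -/

section Calculus

variable {κ κ' : Type*}

theorem tendsto_restrict (S : Finset κ) (z : κ → ℝ) :
    Tendsto (fun (w : κ → ℝ) (s : S) => w s) (𝓝 z) (𝓝 fun s : S => z s) :=
  (continuous_pi fun s : S => continuous_apply (s : κ)).tendsto z

open Classical in
/-- The point with coordinates `x` in `S` and those of `z` elsewhere. -/
def extend (S : Finset κ) (z : κ → ℝ) (x : S → ℝ) : κ → ℝ :=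
  fun k => if h : k ∈ S then x ⟨k, h⟩ else z k

@[simp] theorem extend_mem (S : Finset κ) (z : κ → ℝ) (x : S → ℝ) (s : S) :
    extend S z x s = x s := by simp [extend]

theorem extend_self (S : Finset κ) (z : κ → ℝ) : extend S z (fun s => z s) = z := by
  funext k; simp [extend]

theorem continuous_extend (S : Finset κ) (z : κ → ℝ) : Continuous (extend S z) := by
  refine continuous_pi fun k => ?_
  by_cases h : k ∈ S
  · simpa [extend, h] using continuous_apply _
  · simpa [extend, h] using continuous_const

theorem tendsto_extend (S : Finset κ) (z : κ → ℝ) :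
    Tendsto (extend S z) (𝓝 fun s : S => z s) (𝓝 z) := by
  have := (continuous_extend S z).tendsto (fun s : S => z s)
  rwa [extend_self] at this

/-- Restriction to `S` is continuous and has the continuous section `extend S z` through `z`, so
neighbourhoods in the infinite product and in `ℝ^S` can be exchanged. -/
theorem eventually_restrict_iff {S : Finset κ} {z : κ → ℝ} {p : (S → ℝ) → Prop} :
    (∀ᶠ w in 𝓝 z, p fun s => w s) ↔ ∀ᶠ x in 𝓝 (fun s : S => z s), p x :=
  ⟨fun h => by simpa using (tendsto_extend S z).eventually h,
    fun h => (tendsto_restrict S z).eventually h⟩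

namespace AnalyticNear

variable {S T : Finset κ} {F G : (κ → ℝ) → ℝ} {z : κ → ℝ}

theorem congr (h : AnalyticNear S F z) (e : F =ᶠ[𝓝 z] G) : AnalyticNear S G z := by
  obtain ⟨g, hg, hF⟩ := h
  exact ⟨g, hg, e.symm.trans hF⟩

theorem isGermAt (h : AnalyticNear S F z) : IsGermAt z F := ⟨S, h⟩

theorem eventually (h : AnalyticNear S F z) : ∀ᶠ w in 𝓝 z, AnalyticNear S F w := by
  obtain ⟨g, hg, hF⟩ := h
  filter_upwards [hF.eventually_nhds, (tendsto_restrict S z).eventually hg.eventually_analyticAt]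
    with w h1 h2 using ⟨g, h2, h1⟩

theorem continuousAt (h : AnalyticNear S F z) : ContinuousAt F z := by
  obtain ⟨g, hg, hF⟩ := h
  have h1 : ContinuousAt (fun w : κ → ℝ => g fun s : S => w s) z :=
    ContinuousAt.comp (f := fun (w : κ → ℝ) (s : S) => w s) hg.continuousAt (tendsto_restrict S z)
  exact h1.congr hF.symm

theorem coord {c : κ} (hc : c ∈ S) : AnalyticNear S (fun w => w c) z :=
  ⟨fun x => x ⟨c, hc⟩, (ContinuousLinearMap.proj (R := ℝ) (φ := fun _ : S => ℝ) ⟨c, hc⟩).analyticAt _,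
    .rfl⟩

theorem const (a : ℝ) : AnalyticNear S (fun _ => a) z := ⟨fun _ => a, analyticAt_const, .rfl⟩

theorem mono (hST : S ⊆ T) (h : AnalyticNear S F z) : AnalyticNear T F z := by
  obtain ⟨g, hg, hF⟩ := h
  refine ⟨fun x => g fun s => x ⟨s, hST s.2⟩, ?_, hF⟩
  refine hg.comp_of_eq (f := fun (x : T → ℝ) (s : S) => x ⟨s, hST s.2⟩) ?_ rfl
  exact AnalyticAt.pi fun s =>
    (ContinuousLinearMap.proj (R := ℝ) (φ := fun _ : T => ℝ) ⟨s, hST s.2⟩).analyticAt _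

theorem comp {S : Finset κ} {T : Finset κ'} {F : (κ → ℝ) → ℝ} {G : κ → (κ' → ℝ) → ℝ} {z : κ' → ℝ}
    (hF : AnalyticNear S F fun s => G s z) (hG : ∀ s ∈ S, AnalyticNear T (G s) z)
    (hc : ∀ s, ContinuousAt (G s) z) : AnalyticNear T (fun w => F fun s => G s w) z := by
  obtain ⟨g, hg, hFg⟩ := hF
  choose q hq hGq using fun s : S => hG s s.2
  refine ⟨fun x => g fun s => q s x, ?_, ?_⟩
  · refine hg.comp_of_eq (f := fun (x : T → ℝ) (s : S) => q s x) (AnalyticAt.pi fun s => hq s) ?_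
    funext s
    exact ((hGq s).eq_of_nhds).symm
  · have h1 : Tendsto (fun (w : κ' → ℝ) (s : κ) => G s w) (𝓝 z) (𝓝 fun s => G s z) :=
      tendsto_pi_nhds.2 fun s => hc s
    filter_upwards [h1.eventually hFg, eventually_all.2 hGq] with w h2 h3
    rw [h2]
    congr 1
    funext s
    exact h3 s

theorem add (hF : AnalyticNear S F z) (hG : AnalyticNear S G z) : AnalyticNear S (F + G) z := by
  obtain ⟨f, hf, hF⟩ := hF
  obtain ⟨g, hg, hG⟩ := hG
  exact ⟨f + g, hf.add hg, hF.add hG⟩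

theorem mul (hF : AnalyticNear S F z) (hG : AnalyticNear S G z) : AnalyticNear S (F * G) z := by
  obtain ⟨f, hf, hF⟩ := hF
  obtain ⟨g, hg, hG⟩ := hG
  exact ⟨f * g, hf.mul hg, hF.mul hG⟩

theorem sub (hF : AnalyticNear S F z) (hG : AnalyticNear S G z) : AnalyticNear S (F - G) z := by
  obtain ⟨f, hf, hF⟩ := hF
  obtain ⟨g, hg, hG⟩ := hG
  exact ⟨f - g, hf.sub hg, hF.sub hG⟩

theorem sum {ι : Type*} {s : Finset ι} {F : ι → (κ → ℝ) → ℝ} (h : ∀ i ∈ s, AnalyticNear S (F i) z) :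
    AnalyticNear S (fun w => ∑ i ∈ s, F i w) z := by
  classical
  induction s using Finset.induction_on with
  | empty => simpa using const 0
  | insert i s hi ih =>
    simp only [Finset.sum_insert hi]
    exact (h i (Finset.mem_insert_self _ _)).add
      (ih fun j hj => h j (Finset.mem_insert_of_mem hj))

end AnalyticNear

theorem IsGermAt.continuousAt {F : (κ → ℝ) → ℝ} {z : κ → ℝ} (h : IsGermAt z F) :
    ContinuousAt F z := h.choose_spec.continuousAt

theorem exists_common_support {ι : Type*} {F : ι → (κ → ℝ) → ℝ} {z : κ → ℝ} (s : Finset ι)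
    (h : ∀ i ∈ s, IsGermAt z (F i)) : ∃ T : Finset κ, ∀ i ∈ s, AnalyticNear T (F i) z := by
  classical
  choose! T hT using h
  exact ⟨s.biUnion T, fun i hi => (hT i hi).mono (Finset.subset_biUnion_of_mem T hi)⟩

section GermAlgebra

variable {F G : (κ → ℝ) → ℝ} {z : κ → ℝ}

theorem exists_common_support_two (hF : IsGermAt z F) (hG : IsGermAt z G) :
    ∃ T : Finset κ, AnalyticNear T F z ∧ AnalyticNear T G z := by
  classical
  obtain ⟨S, hS⟩ := hF
  obtain ⟨T, hT⟩ := hG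
  exact ⟨S ∪ T, hS.mono Finset.subset_union_left, hT.mono Finset.subset_union_right⟩

theorem IsGermAt.congr (h : IsGermAt z F) (e : F =ᶠ[𝓝 z] G) : IsGermAt z G :=
  ⟨_, h.choose_spec.congr e⟩

theorem IsGermAt.add (hF : IsGermAt z F) (hG : IsGermAt z G) : IsGermAt z (F + G) := by
  obtain ⟨T, h1, h2⟩ := exists_common_support_two hF hG
  exact ⟨T, h1.add h2⟩

theorem IsGermAt.mul (hF : IsGermAt z F) (hG : IsGermAt z G) : IsGermAt z (F * G) := by
  obtain ⟨T, h1, h2⟩ := exists_common_support_two hF hG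
  exact ⟨T, h1.mul h2⟩

theorem IsGermAt.sub (hF : IsGermAt z F) (hG : IsGermAt z G) : IsGermAt z (F - G) := by
  obtain ⟨T, h1, h2⟩ := exists_common_support_two hF hG
  exact ⟨T, h1.sub h2⟩

theorem isGermAt_const (a : ℝ) : IsGermAt z fun _ => a := ⟨∅, .const a⟩

theorem isGermAt_coord (c : κ) : IsGermAt z fun w => w c :=
  ⟨{c}, .coord (Finset.mem_singleton_self c)⟩

theorem IsGermAt.sum {ι : Type*} {s : Finset ι} {F : ι → (κ → ℝ) → ℝ}
    (h : ∀ i ∈ s, IsGermAt z (F i)) : IsGermAt z (fun w => ∑ i ∈ s, F i w) := by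
  obtain ⟨T, hT⟩ := exists_common_support s h
  exact ⟨T, .sum hT⟩

theorem IsGermAt.comp {F : (κ → ℝ) → ℝ} {G : κ → (κ' → ℝ) → ℝ} {z : κ' → ℝ}
    (hF : IsGermAt (fun s => G s z) F) (hG : ∀ s, IsGermAt z (G s)) :
    IsGermAt z (fun w => F fun s => G s w) := by
  obtain ⟨S, hS⟩ := hF
  obtain ⟨T, hT⟩ := exists_common_support S fun s _ => hG s
  exact ⟨T, hS.comp hT fun s => (hG s).continuousAt⟩

end GermAlgebra

section Derivatives

variable [DecidableEq κ] [DecidableEq κ'] {S : Finset κ} {F G : (κ → ℝ) → ℝ} {z : κ → ℝ}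

theorem tendsto_update (z : κ → ℝ) (c : κ) :
    Tendsto (fun s : ℝ => Function.update z c s) (𝓝 (z c)) (𝓝 z) := by
  have h : Continuous fun s : ℝ => Function.update z c s := continuous_const.update c continuous_id
  simpa using h.tendsto (z c)

theorem pderiv_congr_at (c : κ) (e : F =ᶠ[𝓝 z] G) : pderiv c F z = pderiv c G z :=
  Filter.EventuallyEq.deriv_eq ((tendsto_update z c).eventually e)

theorem pderiv_congr (c : κ) (e : F =ᶠ[𝓝 z] G) : pderiv c F =ᶠ[𝓝 z] pderiv c G := by
  filter_upwards [e.eventually_nhds] with w hw using pderiv_congr_at c hw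

theorem pderiv_coord (c d : κ) (w : κ → ℝ) :
    pderiv c (fun z => z d) w = if c = d then 1 else 0 := by
  unfold pderiv
  by_cases h : c = d
  · subst h; simp
  · simp [h, Function.update_of_ne (Ne.symm h)]

theorem hasDerivAt_comp_of_fderiv {g : (S → ℝ) → ℝ} {γ : ℝ → κ → ℝ} {γ' : κ → ℝ} {t : ℝ}
    (hg : AnalyticAt ℝ g fun s => γ t s) (hγ : ∀ s ∈ S, HasDerivAt (fun t => γ t s) (γ' s) t) :
    HasDerivAt (fun t => g fun s : S => γ t s)
      (∑ s : S, fderiv ℝ g (fun s => γ t s) (Pi.single s 1) * γ' s) t := by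
  have h1 : HasDerivAt (fun t (s : S) => γ t s) (fun s : S => γ' s) t :=
    hasDerivAt_pi.2 fun s => hγ s s.2
  have h2 := hg.differentiableAt.hasFDerivAt.comp_hasDerivAt t h1
  refine HasDerivAt.congr_deriv h2 ?_
  have h3 : (fun s : S => γ' s) = ∑ s : S, γ' s • (Pi.single s 1 : S → ℝ) := by
    funext i
    simp [Finset.sum_apply, Pi.single_apply]
  rw [h3, map_sum]
  exact Finset.sum_congr rfl fun s _ => by rw [map_smul, smul_eq_mul, mul_comm]

theorem pderiv_eq_fderiv {g : (S → ℝ) → ℝ} (hg : AnalyticAt ℝ g fun s => z s)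
    (e : F =ᶠ[𝓝 z] fun w => g fun s => w s) (c : κ) :
    pderiv c F z = if h : c ∈ S then fderiv ℝ g (fun s => z s) (Pi.single ⟨c, h⟩ 1) else 0 := by
  rw [pderiv_congr_at c e]
  have h := hasDerivAt_comp_of_fderiv (S := S) (g := g) (γ := fun s => Function.update z c s)
    (γ' := fun s => if s = c then 1 else 0) (t := z c) (by simpa using hg) (by
      intro s _
      by_cases hs : s = c
      · subst hs; simpa using hasDerivAt_id' (z s)
      · simpa [hs, Function.update_of_ne hs] using hasDerivAt_const _ _)
  unfold pderiv
  rw [h.deriv]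
  simp only [Function.update_eq_self]
  split_ifs with hc
  · rw [Finset.sum_eq_single ⟨c, hc⟩]
    · simp
    · intro s _ hs
      have : (s : κ) ≠ c := fun e => hs (Subtype.ext e)
      simp [this]
    · simp
  · refine Finset.sum_eq_zero fun s _ => ?_
    have : (s : κ) ≠ c := fun e => hc (e ▸ s.2)
    simp [this]

theorem AnalyticNear.hasDerivAt_comp {γ : ℝ → κ → ℝ} {γ' : κ → ℝ} {t : ℝ}
    (hF : AnalyticNear S F (γ t)) (hc : ContinuousAt γ t)
    (hγ : ∀ s ∈ S, HasDerivAt (fun t => γ t s) (γ' s) t) :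
    HasDerivAt (fun t => F (γ t)) (∑ s ∈ S, pderiv s F (γ t) * γ' s) t := by
  obtain ⟨g, hg, e⟩ := hF
  have h := hasDerivAt_comp_of_fderiv hg hγ
  have h2 : (∑ s ∈ S, pderiv s F (γ t) * γ' s) =
      ∑ s : S, fderiv ℝ g (fun s => γ t s) (Pi.single s 1) * γ' s := by
    rw [← Finset.sum_coe_sort]
    refine Finset.sum_congr rfl fun s _ => ?_
    rw [pderiv_eq_fderiv hg e]
    simp
  rw [h2]
  exact h.congr_of_eventuallyEq (hc.eventually e)

theorem AnalyticNear.pderiv_eq_zero (hF : AnalyticNear S F z) {c : κ} (hc : c ∉ S) :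
    pderiv c F z = 0 := by
  obtain ⟨g, hg, e⟩ := hF
  rw [pderiv_eq_fderiv hg e, dif_neg hc]

theorem AnalyticNear.pderiv (hF : AnalyticNear S F z) (c : κ) : AnalyticNear S (pderiv c F) z := by
  by_cases hc : c ∈ S
  · obtain ⟨g, hg, e⟩ := hF
    refine ⟨fun x => fderiv ℝ g x (Pi.single ⟨c, hc⟩ 1),
      ((ContinuousLinearMap.apply ℝ ℝ (Pi.single ⟨c, hc⟩ (1 : ℝ) : S → ℝ)).analyticAt _).comp hg.fderiv,
      ?_⟩
    filter_upwards [e.eventually_nhds,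
      (tendsto_restrict S z).eventually hg.eventually_analyticAt] with w h1 h2
    rw [pderiv_eq_fderiv h2 h1, dif_pos hc]
  · refine (AnalyticNear.const 0).congr ?_
    filter_upwards [hF.eventually] with w hw using (hw.pderiv_eq_zero hc).symm

theorem AnalyticNear.pderiv_iterate (hF : AnalyticNear S F z) (c : κ) (k : ℕ) :
    AnalyticNear S ((Diff.pderiv c)^[k] F) z := by
  induction k with
  | zero => exact hF
  | succ k ih => rw [Function.iterate_succ_apply']; exact ih.pderiv c

theorem AnalyticNear.hasDerivAt (hF : AnalyticNear S F z) (c : κ) :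
    HasDerivAt (fun s => F (Function.update z c s)) (Diff.pderiv c F z) (z c) := by
  have h := AnalyticNear.hasDerivAt_comp (S := S) (F := F) (γ := fun s => Function.update z c s)
    (γ' := fun s => if s = c then 1 else 0) (t := z c)
  simp only [Function.update_eq_self] at h
  refine (h hF ?_ ?_).differentiableAt.hasDerivAt
  · simpa [ContinuousAt] using tendsto_update z c
  · intro s _
    by_cases hs : s = c
    · subst hs; simpa using hasDerivAt_id' (z s)
    · simpa [hs, Function.update_of_ne hs] using hasDerivAt_const _ _

theorem IsGermAt.hasDerivAt (hF : IsGermAt z F) (c : κ) :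
    HasDerivAt (fun s => F (Function.update z c s)) (pderiv c F z) (z c) :=
  hF.choose_spec.hasDerivAt c

theorem IsGermAt.pderiv (hF : IsGermAt z F) (c : κ) : IsGermAt z (pderiv c F) :=
  ⟨_, hF.choose_spec.pderiv c⟩

theorem pderiv_sub (hF : IsGermAt z F) (hG : IsGermAt z G) (c : κ) :
    pderiv c (F - G) z = pderiv c F z - pderiv c G z :=
  ((hF.hasDerivAt c).sub (hG.hasDerivAt c)).deriv

theorem pderiv_comp {F : (κ → ℝ) → ℝ} {G : κ → (κ' → ℝ) → ℝ} {z : κ' → ℝ}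
    (hF : AnalyticNear S F fun s => G s z) (hG : ∀ s, IsGermAt z (G s)) (c : κ') :
    pderiv c (fun w => F fun s => G s w) z =
      ∑ s ∈ S, pderiv s F (fun s => G s z) * pderiv c (G s) z := by
  have h := hF
  have hz : (fun s => G s z) = fun s => G s (Function.update z c (z c)) := by simp
  rw [hz] at h
  have := h.hasDerivAt_comp (γ := fun t s => G s (Function.update z c t))
    (γ' := fun s => pderiv c (G s) z) (t := z c) ?_ fun s _ => (hG s).hasDerivAt c
  · have h2 := this.deriv
    simp only [Function.update_eq_self] at h2
    exact h2
  · exact tendsto_pi_nhds.2 fun s => ((hG s).hasDerivAt c).continuousAt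

theorem vectorField_eq_sum (b : κ → (κ → ℝ) → ℝ) (hF : AnalyticNear S F z) :
    vectorField b F z = ∑ c ∈ S, b c z * pderiv c F z := by
  refine finsum_eq_sum_of_support_subset _ fun c hc => ?_
  by_contra h
  exact hc (by simp [hF.pderiv_eq_zero h])

theorem vectorField_coord (b : κ → (κ → ℝ) → ℝ) (d : κ) :
    vectorField b (fun w => w d) = b d := by
  funext z
  simp only [vectorField, pderiv_coord]
  rw [finsum_eq_single _ d]
  · simp
  · intro c hc; simp [hc]

theorem vectorField_zero (b : κ → (κ → ℝ) → ℝ) : vectorField b (0 : (κ → ℝ) → ℝ) = 0 := by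
  funext z
  simp [vectorField, pderiv]

theorem vectorField_congr_at (b : κ → (κ → ℝ) → ℝ) (e : F =ᶠ[𝓝 z] G) :
    vectorField b F z = vectorField b G z := by
  simp only [vectorField, pderiv_congr_at _ e]

theorem vectorField_congr (b : κ → (κ → ℝ) → ℝ) (e : F =ᶠ[𝓝 z] G) :
    vectorField b F =ᶠ[𝓝 z] vectorField b G := by
  filter_upwards [e.eventually_nhds] with w hw using vectorField_congr_at b hw

/-- The chain rule for a derivation. With `G` the jets it relates derivations of the trivial
diffiety to those of the ordinary one; with `G` the projection to coordinates it handles `lift`. -/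
theorem vectorField_comp (b : κ' → (κ' → ℝ) → ℝ) {F : (κ → ℝ) → ℝ} {G : κ → (κ' → ℝ) → ℝ}
    {z : κ' → ℝ} (hF : AnalyticNear S F fun s => G s z) (hG : ∀ s, IsGermAt z (G s)) :
    vectorField b (fun w => F fun s => G s w) z =
      ∑ s ∈ S, pderiv s F (fun s => G s z) * vectorField b (G s) z := by
  obtain ⟨T, hT⟩ := exists_common_support S fun s _ => hG s
  rw [vectorField_eq_sum b (hF.comp hT fun s => (hG s).continuousAt)]
  have h : ∀ s ∈ S, pderiv s F (fun s => G s z) * vectorField b (G s) z =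
      ∑ c ∈ T, pderiv s F (fun s => G s z) * (b c z * pderiv c (G s) z) := fun s hs => by
    rw [vectorField_eq_sum b (hT s hs), Finset.mul_sum]
  rw [Finset.sum_congr rfl h, Finset.sum_comm]
  refine Finset.sum_congr rfl fun c _ => ?_
  rw [pderiv_comp hF hG, Finset.mul_sum]
  exact Finset.sum_congr rfl fun s _ => by ring

theorem vectorField_sub (b : κ → (κ → ℝ) → ℝ) (hF : IsGermAt z F) (hG : IsGermAt z G) :
    vectorField b (F - G) z = vectorField b F z - vectorField b G z := by
  obtain ⟨T, h1, h2⟩ := exists_common_support_two hF hG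
  rw [vectorField_eq_sum b (h1.sub h2), vectorField_eq_sum b h1, vectorField_eq_sum b h2,
    ← Finset.sum_sub_distrib]
  exact Finset.sum_congr rfl fun c _ => by rw [pderiv_sub hF hG]; ring

theorem IsGermAt.vectorField {b : κ → (κ → ℝ) → ℝ} (hF : IsGermAt z F)
    (hb : ∀ c, IsGermAt z (b c)) : IsGermAt z (vectorField b F) := by
  obtain ⟨S, hS⟩ := hF
  refine (IsGermAt.sum (s := S) fun c _ => (hb c).mul (hS.isGermAt.pderiv c)).congr ?_
  filter_upwards [hS.eventually] with w hw using by simp [vectorField_eq_sum b hw]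

theorem AnalyticNear.vectorField {b : κ → (κ → ℝ) → ℝ} {T : Finset κ} (hF : AnalyticNear S F z)
    (hST : S ⊆ T) (hb : ∀ c ∈ S, AnalyticNear T (b c) z) :
    AnalyticNear T (vectorField b F) z := by
  refine (AnalyticNear.sum (s := S) fun c hc => (hb c hc).mul ((hF.pderiv c).mono hST)).congr ?_
  filter_upwards [hF.eventually] with w hw using by simp [vectorField_eq_sum b hw]

end Derivatives

end Calculus

/-! ### Identity theorem, removal of idle coordinates, vanishing of all Taylor coefficients in one
variable. -/

section Identity

variable {κ : Type*}

/-- The set where the germ is zero is open. It is also closed in `U`: near a limit point `z`, `F` is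
an analytic function on a finite-dimensional ball, and it vanishes near some point of that ball. -/
theorem IsFunctionOn.eventuallyEq_zero {U : Set (κ → ℝ)} (hU : IsPreconnected U)
    {F : (κ → ℝ) → ℝ} (hF : IsFunctionOn U F) {v : κ → ℝ} (hv : v ∈ U) (h0 : F =ᶠ[𝓝 v] 0) :
    ∀ z ∈ U, F =ᶠ[𝓝 z] 0 := by
  obtain ⟨S, hS⟩ := hF
  refine hU.subset_of_closure_inter_subset (u := {z | F =ᶠ[𝓝 z] 0})
    (isOpen_setOfPred_eventually_nhds (p := fun z => F z = 0)) ⟨v, hv, h0⟩ ?_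
  rintro z ⟨hz, hzU⟩
  obtain ⟨g, hg, e⟩ := hS z hzU
  obtain ⟨ε, hε, hball⟩ := Metric.eventually_nhds_iff_ball.1 hg.eventually_analyticAt
  have hN := e.eventually_nhds.and
    ((tendsto_restrict S z).eventually (Metric.ball_mem_nhds (fun s : S => z s) hε))
  obtain ⟨w, hw0, hwe, hwb⟩ := (mem_closure_iff_frequently.1 hz).and_eventually hN |>.exists
  have h1 : ∀ᶠ w' in 𝓝 w, g (fun s => w' s) = 0 := by
    have hw0 : ∀ᶠ w' in 𝓝 w, F w' = 0 := hw0
    filter_upwards [hw0, hwe] with w' h2 h3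
    rw [← h3, h2]
  have h2 : g =ᶠ[𝓝 fun s : S => w s] 0 := eventually_restrict_iff.1 h1
  have h3 := AnalyticOnNhd.eqOn_zero_of_preconnected_of_eventuallyEq_zero (f := g)
    (fun x hx => hball x hx) (convex_ball (fun s : S => z s) ε).isPreconnected hwb h2
  filter_upwards [hN] with w' hw'
  rw [hw'.1.self_of_nhds]
  exact h3 hw'.2

variable [DecidableEq κ]

theorem update_mem_ball {S : Finset κ} {x y : S → ℝ} {ε t : ℝ} (c : S) (hx : x ∈ Metric.ball y ε)
    (ht : t ∈ Metric.ball (y c) ε) : Function.update x c t ∈ Metric.ball y ε := by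
  have hε : 0 < ε := dist_nonneg.trans_lt hx
  refine (dist_pi_lt_iff hε).2 fun s => ?_
  by_cases h : s = c
  · subst h; simpa using ht
  · simpa [Function.update_of_ne h] using (dist_pi_lt_iff hε).1 hx s

theorem hasDerivAt_update_comp {S : Finset κ} {g : (S → ℝ) → ℝ} {x : S → ℝ} {c : S} {t : ℝ}
    (hg : AnalyticAt ℝ g (Function.update x c t)) :
    HasDerivAt (fun t => g (Function.update x c t))
      (fderiv ℝ g (Function.update x c t) (Pi.single c 1)) t :=
  hg.differentiableAt.hasFDerivAt.comp_hasDerivAt t (hasDerivAt_update x c t)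

/-- On a small ball `g` is constant along the direction `c`, so the coordinate `c` may be frozen at
`z c`. -/
theorem AnalyticNear.erase {S : Finset κ} {F : (κ → ℝ) → ℝ} {z : κ → ℝ} (hF : AnalyticNear S F z)
    {c : κ} (h0 : Diff.pderiv c F =ᶠ[𝓝 z] 0) : AnalyticNear (S.erase c) F z := by
  by_cases hc : c ∈ S
  swap
  · rwa [Finset.erase_eq_of_notMem hc]
  obtain ⟨g, hg, e⟩ := hF
  have h1 : ∀ᶠ x in 𝓝 (fun s : S => z s), fderiv ℝ g x (Pi.single ⟨c, hc⟩ 1) = 0 := by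
    refine eventually_restrict_iff.1 ?_
    filter_upwards [h0, e.eventually_nhds,
      (tendsto_restrict S z).eventually hg.eventually_analyticAt] with w h2 h3 h4
    rw [pderiv_eq_fderiv h4 h3, dif_pos hc] at h2
    exact h2
  obtain ⟨ε, hε, hball⟩ := Metric.eventually_nhds_iff_ball.1 (h1.and hg.eventually_analyticAt)
  refine ⟨fun y => g fun s => if h : (s : κ) = c then z c else y ⟨s, Finset.mem_erase.2 ⟨h, s.2⟩⟩,
    ?_, ?_⟩
  · refine hg.comp_of_eq (f := fun (y : S.erase c → ℝ) (s : S) =>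
      if h : (s : κ) = c then z c else y ⟨s, Finset.mem_erase.2 ⟨h, s.2⟩⟩) ?_ ?_
    · refine AnalyticAt.pi fun s => ?_
      by_cases h : (s : κ) = c
      · simp only [h, dite_true]; exact analyticAt_const
      · simp only [h, dite_false]
        exact (ContinuousLinearMap.proj (R := ℝ) (φ := fun _ : S.erase c => ℝ) _).analyticAt _
    · funext s
      by_cases h : (s : κ) = c <;> simp [h]
  · filter_upwards [e, (tendsto_restrict S z).eventually (Metric.ball_mem_nhds _ hε)] with w h2 h3
    rw [h2]
    have h4 : ∀ t ∈ Metric.ball (z c) ε, ∀ t' ∈ Metric.ball (z c) ε,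
        g (Function.update (fun s : S => w s) ⟨c, hc⟩ t) =
          g (Function.update (fun s : S => w s) ⟨c, hc⟩ t') := by
      intro t ht t' ht'
      refine (Metric.isOpen_ball).is_const_of_deriv_eq_zero (convex_ball (z c) ε).isPreconnected
        (f := fun t => g (Function.update (fun s : S => w s) ⟨c, hc⟩ t)) ?_ ?_ ht ht'
      · intro t ht
        exact (hasDerivAt_update_comp (hball _ (update_mem_ball ⟨c, hc⟩ h3 ht)).2).differentiableAt
          |>.differentiableWithinAt
      · intro t ht
        have h5 := hball _ (update_mem_ball ⟨c, hc⟩ h3 ht)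
        rw [(hasDerivAt_update_comp h5.2).deriv, h5.1]
        rfl
    have h6 := h4 (w c) ((dist_pi_lt_iff hε).1 h3 ⟨c, hc⟩) (z c) (Metric.mem_ball_self hε)
    have h7 : Function.update (fun s : S => w s) ⟨c, hc⟩ (w c) = fun s : S => w s :=
      Function.update_eq_self (⟨c, hc⟩ : S) fun s : S => w s
    rw [h7] at h6
    rw [h6]
    congr 1
    funext s
    by_cases h : (s : κ) = c
    · have : s = ⟨c, hc⟩ := Subtype.ext h
      subst this; simp
    · have : s ≠ ⟨c, hc⟩ := fun e => h (congrArg Subtype.val e)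
      simp [h, this]

theorem AnalyticNear.filter {S : Finset κ} {F : (κ → ℝ) → ℝ} {z : κ → ℝ} (hF : AnalyticNear S F z)
    {p : κ → Prop} [DecidablePred p] (h0 : ∀ c ∈ S, ¬ p c → Diff.pderiv c F =ᶠ[𝓝 z] 0) :
    AnalyticNear (S.filter p) F z := by
  have h : ∀ T : Finset κ, T ⊆ S.filter (fun c => ¬ p c) → AnalyticNear (S \ T) F z := by
    intro T
    induction T using Finset.induction_on with
    | empty => intro _; simpa using hF
    | insert c T hc ih =>
      intro hT
      have h1 := ih ((Finset.subset_insert _ _).trans hT)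
      have h2 := Finset.mem_filter.1 (hT (Finset.mem_insert_self c T))
      refine (AnalyticNear.erase h1 (h0 c h2.1 h2.2)).mono ?_
      intro x hx
      simp only [Finset.mem_erase, Finset.mem_sdiff, Finset.mem_insert] at hx ⊢
      tauto
  refine (h _ subset_rfl).mono fun x hx => ?_
  simp only [Finset.mem_sdiff, Finset.mem_filter] at hx ⊢
  tauto

theorem eventually_eq_zero_of_iteratedDeriv {f : ℝ → ℝ} {a : ℝ} (hf : AnalyticAt ℝ f a)
    (h : ∀ k, iteratedDeriv k f a = 0) : f =ᶠ[𝓝 a] 0 := by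
  by_contra hne
  have h1 : analyticOrderAt f a ≠ ⊤ := fun e => hne (analyticOrderAt_eq_top.1 e)
  obtain ⟨n, hn⟩ := ENat.ne_top_iff_exists.1 h1
  exact ((_root_.analyticOrderAt_eq_nat_iff_iteratedDeriv_eq_zero hf).1 hn.symm).2 (h n)

/-- Guarantees that a nonzero germ has a nonzero coefficient in its expansion in powers of `c - z
c`, so that its degree is the index of an actual nonzero coefficient. -/
theorem AnalyticNear.eventuallyEq_zero_of_iterate {S : Finset κ} {F : (κ → ℝ) → ℝ} {z : κ → ℝ}
    (hF : AnalyticNear S F z) {c : κ}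
    (h0 : ∀ k, ∀ᶠ w in 𝓝 z, (Diff.pderiv c)^[k] F (Function.update w c (z c)) = 0) :
    F =ᶠ[𝓝 z] 0 := by
  wlog hc : c ∈ S generalizing S
  · exact this (hF.mono (Finset.subset_insert c S)) (Finset.mem_insert_self c S)
  obtain ⟨g, hg, e⟩ := hF
  obtain ⟨ε, hε, hball⟩ := Metric.eventually_nhds_iff_ball.1 hg.eventually_analyticAt
  set c' : S := ⟨c, hc⟩
  set z' : S → ℝ := fun s => z s
  let d : ((S → ℝ) → ℝ) → (S → ℝ) → ℝ := fun g x => fderiv ℝ g x (Pi.single c' 1)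
  have hd : ∀ k, AnalyticOnNhd ℝ (d^[k] g) (Metric.ball z' ε) := by
    intro k
    induction k with
    | zero => exact hball
    | succ k ih =>
      rw [Function.iterate_succ_apply']
      intro x hx
      exact AnalyticAt.comp (g := fun L : (S → ℝ) →L[ℝ] ℝ => L (Pi.single c' 1))
        ((ContinuousLinearMap.apply ℝ ℝ (Pi.single c' (1 : ℝ) : S → ℝ)).analyticAt _) (ih x hx).fderiv
  have he : ∀ k, (Diff.pderiv c)^[k] F =ᶠ[𝓝 z] fun w => d^[k] g fun s => w s := by
    intro k
    induction k with
    | zero => exact e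
    | succ k ih =>
      simp only [Function.iterate_succ_apply']
      filter_upwards [ih.eventually_nhds,
        (tendsto_restrict S z).eventually (Metric.ball_mem_nhds _ hε)] with w h1 h2
      rw [pderiv_eq_fderiv (hd k _ h2) h1, dif_pos hc]
  -- The neighbourhood in `h0` depends on `k`; the identity theorem makes it the same ball for all
  -- `k`.
  have hzero : ∀ k, ∀ x ∈ Metric.ball z' ε, d^[k] g (Function.update x c' (z c)) = 0 := by
    intro k
    refine AnalyticOnNhd.eqOn_zero_of_preconnected_of_eventuallyEq_zero (𝕜 := ℝ)
      (f := fun x => d^[k] g (Function.update x c' (z c))) (z₀ := z') ?_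
      (convex_ball z' ε).isPreconnected (Metric.mem_ball_self hε) ?_
    · intro x hx
      refine AnalyticAt.comp_of_eq (g := d^[k] g) (f := fun x : S → ℝ => Function.update x c' (z c))
        (hd k _ (update_mem_ball (y := z') c' hx (Metric.mem_ball_self hε))) ?_ rfl
      refine AnalyticAt.pi fun s => ?_
      by_cases h : s = c'
      · subst h; simpa using analyticAt_const
      · simp only [Function.update_of_ne h]
        exact (ContinuousLinearMap.proj (R := ℝ) (φ := fun _ : S => ℝ) s).analyticAt x
    · refine eventually_restrict_iff (z := z) (S := S)
        (p := fun x => d^[k] g (Function.update x c' (z c)) = 0) |>.1 ?_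
      have ht : Tendsto (fun w : κ → ℝ => Function.update w c (z c)) (𝓝 z) (𝓝 z) := by
        have : Continuous fun w : κ → ℝ => Function.update w c (z c) :=
          continuous_id.update c continuous_const
        simpa using this.tendsto z
      filter_upwards [h0 k, ht.eventually (he k)] with w h1 h2
      rw [h2] at h1
      rw [← h1]
      refine congrArg (d^[k] g) (funext fun s => ?_)
      by_cases h : s = c'
      · subst h; simp [c']
      · have : (s : κ) ≠ c := fun e => h (Subtype.ext e)
        simp [this, h]
  have hit : ∀ x ∈ Metric.ball z' ε, ∀ k, ∀ t ∈ Metric.ball (z c) ε,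
      iteratedDeriv k (fun t => g (Function.update x c' t)) t =
        d^[k] g (Function.update x c' t) := by
    intro x hx k
    induction k with
    | zero => intro t _; simp
    | succ k ih =>
      intro t ht
      rw [iteratedDeriv_succ, Function.iterate_succ_apply']
      have : iteratedDeriv k (fun t => g (Function.update x c' t)) =ᶠ[𝓝 t]
          fun t => d^[k] g (Function.update x c' t) := by
        filter_upwards [Metric.isOpen_ball.mem_nhds ht] with t ht using ih t ht
      rw [this.deriv_eq]
      exact (hasDerivAt_update_comp (hd k _ (update_mem_ball (y := z') c' hx ht))).deriv
  have hg0 : ∀ x ∈ Metric.ball z' ε, g x = 0 := by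
    intro x hx
    have han : AnalyticOnNhd ℝ (fun t => g (Function.update x c' t)) (Metric.ball (z c) ε) := by
      intro t ht
      refine (hball _ (update_mem_ball (y := z') c' hx ht)).comp_of_eq
        (f := fun t => Function.update x c' t) ?_ rfl
      refine AnalyticAt.pi fun s => ?_
      by_cases h : s = c'
      · subst h; simp only [Function.update_self]; exact analyticAt_id
      · simpa [Function.update_of_ne h] using analyticAt_const
    have h1 := han.eqOn_zero_of_preconnected_of_eventuallyEq_zero
      (convex_ball (z c) ε).isPreconnected (Metric.mem_ball_self hε)
      (eventually_eq_zero_of_iteratedDeriv (han _ (Metric.mem_ball_self hε)) fun k => by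
        rw [hit x hx k _ (Metric.mem_ball_self hε), hzero k x hx])
    have h2 := h1 ((dist_pi_lt_iff hε).1 hx c')
    simpa using h2
  filter_upwards [e, (tendsto_restrict S z).eventually (Metric.ball_mem_nhds _ hε)] with w h1 h2
  rw [h1]
  exact hg0 _ h2

end Identity

/-! ### Analytic divided differences. -/

section Division

variable {E : Type*} [NormedAddCommGroup E] [NormedSpace ℝ E]

/-- The power series of `h` such that `g x - g y = h (x, y) (x - y)`, where `p` is the power
series of `g`. -/
def dividedDifferenceSeries (p : FormalMultilinearSeries ℝ E ℝ) :
    FormalMultilinearSeries ℝ (E × E) (E →L[ℝ] ℝ) := fun n =>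
  ∑ j : Fin (n + 1),
    (ContinuousLinearMap.flipMultilinear ((p (n + 1)).curryMid j)).compContinuousLinearMap
      fun i : Fin n => if (i : ℕ) < j then ContinuousLinearMap.fst ℝ E E
        else ContinuousLinearMap.snd ℝ E E

theorem norm_dividedDifferenceSeries_le (p : FormalMultilinearSeries ℝ E ℝ) (n : ℕ) :
    ‖dividedDifferenceSeries p n‖ ≤ (n + 1) * ‖p (n + 1)‖ := by
  have hsum : (n + 1) * ‖p (n + 1)‖ = ∑ _j : Fin (n + 1), ‖p (n + 1)‖ := by simp
  rw [hsum]
  refine (norm_sum_le (E := ContinuousMultilinearMap ℝ (fun _ : Fin n => E × E) (E →L[ℝ] ℝ))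
    _ _).trans (Finset.sum_le_sum fun j _ => ?_)
  refine (ContinuousMultilinearMap.norm_compContinuousLinearMap_le _ _).trans ?_
  have h1 : ‖ContinuousLinearMap.flipMultilinear ((p (n + 1)).curryMid j)‖ ≤ ‖p (n + 1)‖ := by
    rw [← ContinuousMultilinearMap.norm_curryMid j (p (n + 1))]
    exact MultilinearMap.mkContinuous_norm_le _ (norm_nonneg _) _
  refine (mul_le_mul h1 (Finset.prod_le_one (fun _ _ => norm_nonneg _) fun i _ => ?_)
    (Finset.prod_nonneg fun _ _ => norm_nonneg _) (norm_nonneg _)).trans (mul_one _).le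
  split_ifs
  · exact ContinuousLinearMap.norm_fst_le ..
  · exact ContinuousLinearMap.norm_snd_le ..

/-- Telescoping: the arguments `y` are replaced by `x` one slot at a time, and the `j`-th summand is
the change in slot `j`. -/
theorem dividedDifferenceSeries_apply (p : FormalMultilinearSeries ℝ E ℝ) (n : ℕ) (x y : E) :
    dividedDifferenceSeries p n (fun _ => (x, y)) (x - y) =
      p (n + 1) (fun _ => x) - p (n + 1) (fun _ => y) := by
  let u : ℕ → Fin (n + 1) → E := fun j i => if (i : ℕ) < j then x else y
  have h1 : ∀ j : Fin (n + 1), (ContinuousLinearMap.flipMultilinear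
      ((p (n + 1)).curryMid j)).compContinuousLinearMap
      (fun i : Fin n => if (i : ℕ) < j then ContinuousLinearMap.fst ℝ E E
        else ContinuousLinearMap.snd ℝ E E) (fun _ => (x, y)) (x - y) =
      p (n + 1) (u (j + 1)) - p (n + 1) (u j) := by
    intro j
    have h2 : ∀ e : E, j.insertNth e (fun i : Fin n => if (i : ℕ) < j then x else y) =
        Function.update (u j) j e := by
      intro e
      rw [Fin.insertNth_eq_iff]
      refine ⟨by simp, ?_⟩
      funext i
      have hne := Fin.succAbove_ne j i
      by_cases hi : (i : ℕ) < j
      · have : j.succAbove i = i.castSucc := Fin.succAbove_of_castSucc_lt _ _ hi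
        rw [this] at hne
        simpa [Fin.removeNth, u, this, hi, hne] using fun h : j ≤ i.castSucc => absurd hi (not_lt.2 h)
      · have : j.succAbove i = i.succ := Fin.succAbove_of_le_castSucc _ _ (not_lt.1 hi)
        have h3 : ¬ ((i : ℕ) + 1 < j) := by omega
        rw [this] at hne
        simpa [Fin.removeNth, u, this, hi, hne] using fun h : i.succ < j => absurd h h3
    have h3 : u (j + 1) = Function.update (u j) j x := by
      funext i
      by_cases hi : i = j
      · subst hi; simp [u]
      · have : (i : ℕ) ≠ j := fun e => hi (Fin.ext e)
        have : (i : ℕ) < j + 1 ↔ (i : ℕ) < j := by omega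
        simp [u, hi, this]
    have h4 : u j = Function.update (u j) j y := by
      funext i
      by_cases hi : i = j
      · subst hi; simp [u]
      · simp [hi]
    have h5 := (p (n + 1)).toMultilinearMap.map_update_sub (u j) j x y
    rw [h3]
    refine Eq.trans ?_ (h5.trans (congrArg₂ (· - ·) rfl
      (congrArg (fun w => p (n + 1) w) h4.symm)))
    rw [← h2]
    simp only [ContinuousMultilinearMap.compContinuousLinearMap_apply,
      ContinuousLinearMap.flipMultilinear_apply_apply, ContinuousMultilinearMap.curryMid_apply]
    refine congrArg (fun w => p (n + 1) (j.insertNth (x - y) w)) (funext fun i => ?_)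
    split_ifs <;> rfl
  have h2 : dividedDifferenceSeries p n (fun _ => (x, y)) (x - y) =
      ∑ j : Fin (n + 1), (p (n + 1) (u (j + 1)) - p (n + 1) (u j)) := by
    rw [← Finset.sum_congr rfl fun j _ => h1 j]
    simp [dividedDifferenceSeries]
  rw [h2, Fin.sum_univ_eq_sum_range (fun j => p (n + 1) (u (j + 1)) - p (n + 1) (u j)) (n + 1),
    Finset.sum_range_sub (fun j => p (n + 1) (u j))]
  have h3 : u (n + 1) = fun _ => x := funext fun i => if_pos i.2
  have h4 : u 0 = fun _ => y := funext fun i => if_neg (Nat.not_lt_zero _)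
  rw [h3, h4]

theorem dividedDifferenceSeries_radius_pos {p : FormalMultilinearSeries ℝ E ℝ}
    (hp : 0 < p.radius) : 0 < (dividedDifferenceSeries p).radius := by
  obtain ⟨C, r, hC, hr, h⟩ := p.le_mul_pow_of_radius_pos hp
  -- The terms are at most `(n + 1) C r^(n+1)`; the factor `n + 1 ≤ 2^n` is absorbed by halving the
  -- radius `1 / r`.
  have hs : (0 : ℝ) < (2 * r)⁻¹ := by positivity
  lift (2 * r)⁻¹ to NNReal using hs.le with s hs'
  refine lt_of_lt_of_le (b := (s : ENNReal)) (by simpa using hs) ?_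
  refine FormalMultilinearSeries.le_radius_of_bound _ (C * r) fun n => ?_
  have h2 : (s : ℝ) = (2 * r)⁻¹ := hs'
  have h1 : ((n : ℝ) + 1) ≤ 2 ^ n := by exact_mod_cast Nat.lt_two_pow_self
  calc ‖dividedDifferenceSeries p n‖ * (s : ℝ) ^ n
      ≤ ((n + 1) * ‖p (n + 1)‖) * (s : ℝ) ^ n := by
        gcongr; exact norm_dividedDifferenceSeries_le p n
    _ ≤ (2 ^ n * (C * r ^ (n + 1))) * (s : ℝ) ^ n := by
        gcongr; exact h _
    _ = C * r := by
        rw [h2, inv_pow, mul_pow]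
        field_simp
        ring

/-- An analytic Hadamard lemma. It shows that an analytic function takes congruent arguments to
congruent values modulo an ideal, even though the function is not polynomial. -/
theorem AnalyticAt.exists_dividedDifference {g : E → ℝ} {z : E} (hg : AnalyticAt ℝ g z) :
    ∃ h : E × E → E →L[ℝ] ℝ, AnalyticAt ℝ h (z, z) ∧
      ∀ᶠ q in 𝓝 (z, z), g q.1 - g q.2 = h q (q.1 - q.2) := by
  obtain ⟨p, r, hp⟩ := hg
  have hq := (dividedDifferenceSeries p).hasFPowerSeriesOnBall
    (dividedDifferenceSeries_radius_pos (hp.r_pos.trans_le hp.r_le))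
  have hq2 := hq.comp_sub (z, z)
  rw [zero_add] at hq2
  refine ⟨_, hq2.analyticAt, ?_⟩
  have h1 : ∀ᶠ q in 𝓝 (z, z), q ∈ Metric.eball (z, z) (dividedDifferenceSeries p).radius :=
    Metric.eball_mem_nhds _ hq2.r_pos
  have h2 : ∀ᶠ q : E × E in 𝓝 (z, z), q.1 ∈ Metric.eball z r :=
    continuous_fst.continuousAt.eventually (Metric.eball_mem_nhds z hp.r_pos)
  have h3 : ∀ᶠ q : E × E in 𝓝 (z, z), q.2 ∈ Metric.eball z r :=
    continuous_snd.continuousAt.eventually (Metric.eball_mem_nhds z hp.r_pos)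
  filter_upwards [h1, h2, h3] with q h1 h2 h3
  have e1 := hq2.hasSum_sub h1
  have e2 := (hasSum_nat_add_iff' 1).2 (hp.hasSum_sub h2)
  have e3 := (hasSum_nat_add_iff' 1).2 (hp.hasSum_sub h3)
  have e4 := (ContinuousLinearMap.apply ℝ ℝ (q.1 - q.2)).hasSum e1
  have e5 := e2.sub e3
  have h6 : ∀ n, dividedDifferenceSeries p n (fun _ => q - (z, z)) (q.1 - q.2) =
      p (n + 1) (fun _ => q.1 - z) - p (n + 1) (fun _ => q.2 - z) := fun n => by
    rw [← dividedDifferenceSeries_apply, sub_sub_sub_cancel_right]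
    rfl
  have h7 := e4.unique (by simpa only [Function.comp_def, ContinuousLinearMap.apply_apply, h6] using e5)
  simp only [ContinuousLinearMap.apply_apply] at h7
  have h8 : (p 0 fun _ => q.1 - z) = p 0 fun _ => q.2 - z := congrArg (p 0) (Subsingleton.elim _ _)
  rw [h7, Finset.sum_range_one, Finset.sum_range_one, h8]
  ring

end Division

section FunctionsOn

variable {κ : Type*} {U : Set (κ → ℝ)} {F G : (κ → ℝ) → ℝ} {z : κ → ℝ}

theorem IsFunctionOn.isGermAt (hF : IsFunctionOn U F) (hz : z ∈ U) : IsGermAt z F :=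
  ⟨_, hF.choose_spec z hz⟩

theorem isFunctionOn_coord (c : κ) : IsFunctionOn U fun z => z c :=
  ⟨{c}, fun _ _ => .coord (Finset.mem_singleton_self c)⟩

variable [DecidableEq κ]

theorem IsFunctionOn.vectorField {b : κ → (κ → ℝ) → ℝ} (hF : IsFunctionOn U F)
    (hb : ∀ c, IsFunctionOn U (b c)) : IsFunctionOn U (vectorField b F) := by
  obtain ⟨S, hS⟩ := hF
  choose T hT using hb
  refine ⟨S ∪ S.biUnion T, fun z hz => (hS z hz).vectorField Finset.subset_union_left
    fun c hc => (hT c z hz).mono ?_⟩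
  exact (Finset.subset_biUnion_of_mem T hc).trans Finset.subset_union_right

theorem IsFunctionOn.pderiv (hF : IsFunctionOn U F) (c : κ) : IsFunctionOn U (pderiv c F) :=
  ⟨_, fun z hz => (hF.choose_spec z hz).pderiv c⟩

theorem vectorField_eqOn (hU : IsOpen U) (b : κ → (κ → ℝ) → ℝ) (h : Set.EqOn F G U) :
    Set.EqOn (vectorField b F) (vectorField b G) U := fun _ hz =>
  vectorField_congr_at b (h.eventuallyEq_of_mem (hU.mem_nhds hz))

end FunctionsOn

variable {m p : ℕ}

/-! ### The functions `τ^a δ^b x_i` and pullback to the ordinary diffiety. -/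

section Jets

variable {V : OrdDiffiety m p}

theorem OrdDiffiety.isFunctionOn_cartanCoeff (c : Coord m p) :
    IsFunctionOn V.U (V.cartanCoeff c) := by
  rcases c with ⟨i, k⟩ | j
  · exact isFunctionOn_coord _
  · exact V.f_analytic j

theorem IsFunctionOn.tau {F : (Coord m p → ℝ) → ℝ} (hF : IsFunctionOn V.U F) :
    IsFunctionOn V.U (V.tau F) := hF.vectorField V.isFunctionOn_cartanCoeff

theorem IsFunctionOn.tau_iterate {F : (Coord m p → ℝ) → ℝ} (hF : IsFunctionOn V.U F) (a : ℕ) :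
    IsFunctionOn V.U (V.tau^[a] F) := by
  induction a with
  | zero => exact hF
  | succ a ih => rw [Function.iterate_succ_apply']; exact ih.tau

variable (D : Symmetry V)

theorem IsFunctionOn.delta {F : (Coord m p → ℝ) → ℝ} (hF : IsFunctionOn V.U F) :
    IsFunctionOn V.U (D.delta F) := hF.vectorField D.coeff_analytic

theorem IsFunctionOn.delta_iterate {F : (Coord m p → ℝ) → ℝ} (hF : IsFunctionOn V.U F) (b : ℕ) :
    IsFunctionOn V.U (D.delta^[b] F) := by
  induction b with
  | zero => exact hF
  | succ b ih => rw [Function.iterate_succ_apply']; exact ih.delta D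

namespace Symmetry

/-- The function `τ^a δ^b x_i` on the ordinary diffiety. -/
def jet (υ : Der m p) : (Coord m p → ℝ) → ℝ :=
  V.tau^[υ.2.1] (D.delta^[υ.2.2] (fun z => z (Coord.x υ.1)))

theorem isFunctionOn_jet (υ : Der m p) : IsFunctionOn V.U (D.jet υ) :=
  ((isFunctionOn_coord _).delta_iterate D _).tau_iterate _

theorem isGermAt_jet {v : Coord m p → ℝ} (hv : v ∈ V.U) (υ : Der m p) : IsGermAt v (D.jet υ) :=
  (D.isFunctionOn_jet υ).isGermAt hv

theorem tendsto_point {v : Coord m p → ℝ} (hv : v ∈ V.U) :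
    Tendsto D.point (𝓝 v) (𝓝 (D.point v)) :=
  tendsto_pi_nhds.2 fun υ => (D.isGermAt_jet hv υ).continuousAt

theorem tau_jet (υ : Der m p) : V.tau (D.jet υ) = D.jet υ.tau := by
  simp only [jet, Der.tau, Function.iterate_succ_apply']

theorem delta_tau_iterate {F : (Coord m p → ℝ) → ℝ} (hF : IsFunctionOn V.U F) (a : ℕ) :
    Set.EqOn (D.delta (V.tau^[a] F)) (V.tau^[a] (D.delta F)) V.U := by
  induction a with
  | zero => exact fun _ _ => rfl
  | succ a ih =>
    intro z hz
    rw [Function.iterate_succ_apply', Function.iterate_succ_apply']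
    exact (D.commutes _ (hF.tau_iterate a) z hz).trans (vectorField_eqOn V.isOpen _ ih hz)

theorem delta_jet (υ : Der m p) : Set.EqOn (D.delta (D.jet υ)) (D.jet υ.delta) V.U := by
  intro z hz
  have := D.delta_tau_iterate ((isFunctionOn_coord (Coord.x υ.1)).delta_iterate D υ.2.2) υ.2.1 hz
  simpa only [jet, Der.delta, Function.iterate_succ_apply'] using this

theorem jet_toDer (c : Coord m p) : D.jet c.toDer = fun z => z c := by
  rcases c with ⟨i, k⟩ | j
  · induction k with
    | zero => rfl
    | succ k ih =>
      have h := D.tau_jet (Sum.inl i, k, 0)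
      rw [show Coord.toDer (Sum.inl (i, k + 1) : Coord m p) =
        Der.tau (Sum.inl i, k, 0) from rfl, ← h]
      rw [show D.jet (Sum.inl i, k, 0) = _ from ih]
      exact vectorField_coord _ _
  · rfl

theorem point_toDer (v : Coord m p → ℝ) : (fun c : Coord m p => D.point v c.toDer) = v :=
  funext fun c => congrFun (D.jet_toDer c) v

section Pullback

variable {v : Coord m p → ℝ} (hv : v ∈ V.U) {P : (Der m p → ℝ) → ℝ}
include hv

theorem tauT_comp_point (hP : IsGermAt (D.point v) P) :
    (fun z => tauT P (D.point z)) =ᶠ[𝓝 v] V.tau fun z => P (D.point z) := by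
  obtain ⟨S, hS⟩ := hP
  filter_upwards [(D.tendsto_point hv).eventually hS.eventually, V.isOpen.mem_nhds hv] with z hz hzU
  refine (vectorField_eq_sum _ hz).trans ?_
  refine Eq.trans ?_ (vectorField_comp _ (G := D.jet) hz fun υ => D.isGermAt_jet hzU υ).symm
  refine Finset.sum_congr rfl fun s _ => ?_
  rw [mul_comm]
  congr 1
  exact (congrFun (D.tau_jet s) z).symm

theorem deltaT_comp_point (hP : IsGermAt (D.point v) P) :
    (fun z => deltaT P (D.point z)) =ᶠ[𝓝 v] D.delta fun z => P (D.point z) := by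
  obtain ⟨S, hS⟩ := hP
  filter_upwards [(D.tendsto_point hv).eventually hS.eventually, V.isOpen.mem_nhds hv] with z hz hzU
  refine (vectorField_eq_sum _ hz).trans ?_
  refine Eq.trans ?_ (vectorField_comp _ (G := D.jet) hz fun υ => D.isGermAt_jet hzU υ).symm
  refine Finset.sum_congr rfl fun s _ => ?_
  rw [mul_comm]
  congr 1
  exact (D.delta_jet s hzU).symm

end Pullback

end Symmetry

end Jets

section Lift

theorem isGermAt_tauT {η : Der m p → ℝ} {P : (Der m p → ℝ) → ℝ} (hP : IsGermAt η P) :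
    IsGermAt η (tauT P) := hP.vectorField fun _ => isGermAt_coord _

theorem isGermAt_deltaT {η : Der m p → ℝ} {P : (Der m p → ℝ) → ℝ} (hP : IsGermAt η P) :
    IsGermAt η (deltaT P) := hP.vectorField fun _ => isGermAt_coord _

variable {V : OrdDiffiety m p} (D : Symmetry V) {v : Coord m p → ℝ}

theorem tendsto_toDer (η : Der m p → ℝ) :
    Tendsto (fun (z : Der m p → ℝ) (c : Coord m p) => z c.toDer) (𝓝 η) (𝓝 fun c => η c.toDer) :=
  tendsto_pi_nhds.2 fun _ => (continuous_apply _).tendsto η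

namespace Symmetry

theorem isGermAt_lift {F : (Coord m p → ℝ) → ℝ} (hF : IsGermAt v F) :
    IsGermAt (D.point v) (lift F) :=
  IsGermAt.comp (G := fun (c : Coord m p) (z : Der m p → ℝ) => z c.toDer)
    (by simpa only [D.point_toDer] using hF) fun _ => isGermAt_coord _

theorem eventually_toDer {q : (Coord m p → ℝ) → Prop} (h : ∀ᶠ z in 𝓝 v, q z) :
    ∀ᶠ z in 𝓝 (D.point v), q fun c => z c.toDer := by
  have := tendsto_toDer (D.point v)
  rw [D.point_toDer] at this
  exact this.eventually h

theorem lift_congr {F G : (Coord m p → ℝ) → ℝ} (e : F =ᶠ[𝓝 v] G) :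
    lift F =ᶠ[𝓝 (D.point v)] lift G := D.eventually_toDer e

theorem isGermAt_equations (hv : v ∈ V.U) {P : (Der m p → ℝ) → ℝ} (hP : P ∈ D.equations) :
    IsGermAt (D.point v) P := by
  rcases hP with ⟨i, rfl⟩ | ⟨j, rfl⟩
  · exact (isGermAt_coord _).sub (D.isGermAt_lift ((D.coeff_analytic _).isGermAt hv))
  · exact (isGermAt_coord _).sub (D.isGermAt_lift ((V.f_analytic _).isGermAt hv))

theorem equations_point {P : (Der m p → ℝ) → ℝ} (hP : P ∈ D.equations) (z : Coord m p → ℝ) :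
    P (D.point z) = 0 := by
  rcases hP with ⟨i, rfl⟩ | ⟨j, rfl⟩
  · change D.delta (fun z => z (Coord.x i)) z - D.coeff (Coord.x i) (fun c => D.point z c.toDer) = 0
    rw [D.point_toDer, sub_eq_zero]
    exact congrFun (vectorField_coord _ _) z
  · change V.tau (fun z => z (Sum.inr j)) z - V.f j (fun c => D.point z c.toDer) = 0
    rw [D.point_toDer, sub_eq_zero]
    exact congrFun (vectorField_coord _ _) z

/-- The elements of the ideal are germs that vanish on the partial diffiety. -/
theorem InIdeal.vanish (hv : v ∈ V.U) {P : (Der m p → ℝ) → ℝ} (hP : D.InIdeal v P) :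
    IsGermAt (D.point v) P ∧ (fun z => P (D.point z)) =ᶠ[𝓝 v] 0 := by
  induction hP with
  | gen P hP => exact ⟨D.isGermAt_equations hv hP, .of_eq (funext fun z => D.equations_point hP z)⟩
  | zero => exact ⟨isGermAt_const 0, .rfl⟩
  | add P Q _ _ ihP ihQ =>
    refine ⟨ihP.1.add ihQ.1, ?_⟩
    filter_upwards [ihP.2, ihQ.2] with z h1 h2
    simp_all
  | mul C P hC _ ihP =>
    refine ⟨hC.mul ihP.1, ?_⟩
    filter_upwards [ihP.2] with z h1
    simp_all
  | tau P _ ihP =>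
    refine ⟨isGermAt_tauT ihP.1, (D.tauT_comp_point hv ihP.1).trans ?_⟩
    refine (vectorField_congr _ ihP.2).trans (.of_eq (vectorField_zero _))
  | delta P _ ihP =>
    refine ⟨isGermAt_deltaT ihP.1, (D.deltaT_comp_point hv ihP.1).trans ?_⟩
    refine (vectorField_congr _ ihP.2).trans (.of_eq (vectorField_zero _))
  | congr P Q e _ ihP =>
    refine ⟨ihP.1.congr e, EventuallyEq.trans ?_ ihP.2⟩
    exact (D.tendsto_point hv).eventually e.symm

end Symmetry

end Lift

/-! ### Congruences modulo the differential ideal. -/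

section Ideal

variable {η : Der m p → ℝ} {E : Set ((Der m p → ℝ) → ℝ)} {P Q R : (Der m p → ℝ) → ℝ}

theorem InDiffIdeal.sub_trans (h1 : InDiffIdeal η E (P - Q)) (h2 : InDiffIdeal η E (Q - R)) :
    InDiffIdeal η E (P - R) := by
  have := InDiffIdeal.add _ _ h1 h2
  rwa [sub_add_sub_cancel] at this

theorem InDiffIdeal.sub_self (P : (Der m p → ℝ) → ℝ) : InDiffIdeal η E (P - P) := by
  rw [_root_.sub_self]; exact .zero

theorem InDiffIdeal.sum {ι : Type*} {s : Finset ι} {F : ι → (Der m p → ℝ) → ℝ}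
    (h : ∀ i ∈ s, InDiffIdeal η E (F i)) : InDiffIdeal η E (fun w => ∑ i ∈ s, F i w) := by
  classical
  induction s using Finset.induction_on with
  | empty => exact .congr _ _ (.of_eq (by funext z; simp)) .zero
  | insert i s hi ih =>
    simp only [Finset.sum_insert hi]
    exact .add _ _ (h i (Finset.mem_insert_self _ _))
      (ih fun j hj => h j (Finset.mem_insert_of_mem hj))

/-- Substituting congruent germs into an analytic function gives congruent germs. -/
theorem InDiffIdeal.comp_sub_comp {κ : Type*} {F : (κ → ℝ) → ℝ} {G H : κ → (Der m p → ℝ) → ℝ}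
    (hF : IsGermAt (fun s => G s η) F) (hG : ∀ s, IsGermAt η (G s)) (hH : ∀ s, IsGermAt η (H s))
    (hGH : ∀ s, G s η = H s η) (h : ∀ s, InDiffIdeal η E (G s - H s)) :
    InDiffIdeal η E ((fun z => F fun s => G s z) - fun z => F fun s => H s z) := by
  classical
  obtain ⟨S, g, hg, e⟩ := hF
  obtain ⟨q, hq, hqe⟩ := AnalyticAt.exists_dividedDifference hg
  have hGt : Tendsto (fun z s => G s z) (𝓝 η) (𝓝 fun s => G s η) :=
    tendsto_pi_nhds.2 fun s => (hG s).continuousAt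
  have hHt : Tendsto (fun z s => H s z) (𝓝 η) (𝓝 fun s => G s η) := by
    rw [funext hGH]
    exact tendsto_pi_nhds.2 fun s => (hH s).continuousAt
  -- The coefficient `q` is analytic only near the diagonal; `hGH` ensures that the pair of
  -- arguments lies on the diagonal at `η`.
  have hcoef : ∀ s : S, IsGermAt η fun z =>
      q (fun s => G s z, fun s => H s z) (Pi.single s 1) := by
    intro s
    obtain ⟨T, hT⟩ := exists_common_support (Finset.univ : Finset (S ⊕ S))
      (F := Sum.elim (fun s : S => G s) fun s : S => H s) (z := η) (by
        rintro (s | s) -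
        exacts [hG s, hH s])
    choose a ha hae using fun s : S => hT (Sum.inl s) (Finset.mem_univ _)
    choose b hb hbe using fun s : S => hT (Sum.inr s) (Finset.mem_univ _)
    refine ⟨T, fun x => q (fun s => a s x, fun s => b s x) (Pi.single s 1), ?_, ?_⟩
    · have h1 : AnalyticAt ℝ (fun x => q (fun s => a s x, fun s => b s x)) fun t : T => η t := by
        refine AnalyticAt.comp_of_eq (g := q)
          (f := fun x => ((fun s => a s x, fun s => b s x) : (S → ℝ) × (S → ℝ))) hq
          ((AnalyticAt.pi ha).prod (AnalyticAt.pi hb)) ?_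
        refine Prod.ext (funext fun s => (hae s).eq_of_nhds.symm) (funext fun s => ?_)
        exact (hbe s).eq_of_nhds.symm.trans (hGH s).symm
      exact AnalyticAt.comp (g := fun L : (S → ℝ) →L[ℝ] ℝ => L (Pi.single s 1))
        ((ContinuousLinearMap.apply ℝ ℝ (Pi.single s (1 : ℝ) : S → ℝ)).analyticAt _) h1
    · filter_upwards [eventually_all.2 hae, eventually_all.2 hbe] with z h1 h2
      simp only [Sum.elim_inl, Sum.elim_inr] at h1 h2
      simp only [h1, h2]
  have hsum := InDiffIdeal.sum (s := (Finset.univ : Finset S)) fun s _ =>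
    InDiffIdeal.mul _ _ (hcoef s) (h s)
  refine .congr _ _ ?_ hsum
  have hpair : Tendsto (fun z => ((fun s : S => G s z, fun s : S => H s z) : (S → ℝ) × (S → ℝ)))
      (𝓝 η) (𝓝 (fun s : S => G s η, fun s : S => G s η)) :=
    ((tendsto_restrict S _).comp hGt).prodMk_nhds ((tendsto_restrict S _).comp hHt)
  filter_upwards [hGt.eventually e, hHt.eventually e, hpair.eventually hqe] with z h1 h2 h3
  simp only [Pi.sub_apply, Pi.mul_apply]
  rw [h1, h2, h3]
  have h4 : (fun s : S => G s z) - (fun s : S => H s z) =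
      ∑ s : S, (G s z - H s z) • (Pi.single s 1 : S → ℝ) := by
    funext i
    simp [Finset.sum_apply, Pi.single_apply]
  rw [h4, map_sum]
  exact Finset.sum_congr rfl fun s _ => by rw [map_smul, smul_eq_mul, mul_comm]

end Ideal

namespace Symmetry

variable {V : OrdDiffiety m p} (D : Symmetry V) {v : Coord m p → ℝ}

/-- By the chain rule the difference is a combination, with coefficients `∂F/∂c`, of the differences
for the coordinates `c`. It serves for both `τ` and `δ`. -/
theorem vectorField_lift_sub_mem {θ : Der m p → Der m p} {β : Coord m p → (Coord m p → ℝ) → ℝ}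
    (h : ∀ c : Coord m p, D.InIdeal v ((fun z => z (θ c.toDer)) - lift (β c)))
    {F : (Coord m p → ℝ) → ℝ} (hF : IsGermAt v F) :
    D.InIdeal v (vectorField (fun υ z => z (θ υ)) (lift F) - lift (vectorField β F)) := by
  obtain ⟨S, hS⟩ := hF
  refine InDiffIdeal.congr _ _ ?_ (InDiffIdeal.sum (s := S) fun c _ =>
    InDiffIdeal.mul _ _ (D.isGermAt_lift (hS.isGermAt.pderiv c)) (h c))
  filter_upwards [D.eventually_toDer hS.eventually] with z hz
  have h1 := vectorField_comp (fun υ z => z (θ υ)) (G := fun (c : Coord m p) (z : Der m p → ℝ) =>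
    z c.toDer) hz fun _ => isGermAt_coord _
  have h2 := vectorField_eq_sum β hz
  simp only [Pi.sub_apply]
  rw [show vectorField (fun υ z => z (θ υ)) (lift F) z = _ from h1,
    show lift (vectorField β F) z = _ from h2, ← Finset.sum_sub_distrib]
  refine Finset.sum_congr rfl fun c _ => ?_
  rw [vectorField_coord]
  simp only [lift, Pi.mul_apply, Pi.sub_apply]
  ring

theorem tau_toDer_sub_mem (c : Coord m p) :
    D.InIdeal v ((fun z => z c.toDer.tau) - lift (V.cartanCoeff c)) := by
  rcases c with ⟨i, k⟩ | j
  · exact InDiffIdeal.sub_self _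
  · exact .gen _ (Or.inr ⟨j, rfl⟩)

theorem tauT_lift_sub_mem {F : (Coord m p → ℝ) → ℝ} (hF : IsGermAt v F) :
    D.InIdeal v (tauT (lift F) - lift (V.tau F)) :=
  D.vectorField_lift_sub_mem (θ := Der.tau) (fun c => D.tau_toDer_sub_mem c) hF

theorem tau_sub_lift_mem {υ : Der m p} {F : (Coord m p → ℝ) → ℝ} (hF : IsGermAt v F)
    (h : D.InIdeal v ((fun z => z υ) - lift F)) :
    D.InIdeal v ((fun z => z υ.tau) - lift (V.tau F)) := by
  refine InDiffIdeal.sub_trans (Q := tauT (lift F)) (.congr _ _ ?_ (.tau _ h))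
    (D.tauT_lift_sub_mem hF)
  filter_upwards [(D.isGermAt_lift hF).choose_spec.eventually] with z hz
  refine (vectorField_sub _ (isGermAt_coord _) hz.isGermAt).trans ?_
  rw [vectorField_coord]
  rfl

/-- The generators give this for the `x_i` only; it propagates to the `x_i^(k)` by applying `τ` to
the relation and using `δτ = τδ`. -/
theorem delta_toDer_sub_mem (hv : v ∈ V.U) (c : Coord m p) :
    D.InIdeal v ((fun z => z c.toDer.delta) - lift (D.coeff c)) := by
  rcases c with ⟨i, k⟩ | j
  · induction k with
    | zero => exact .gen _ (Or.inl ⟨Sum.inl i, rfl⟩)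
    | succ k ih =>
      have h := D.tau_sub_lift_mem ((D.coeff_analytic _).isGermAt hv) ih
      refine .congr _ _ (.sub .rfl (D.lift_congr ?_)) h
      filter_upwards [V.isOpen.mem_nhds hv] with z hz
      have h1 := D.commutes (fun z => z (Sum.inl (i, k))) (isFunctionOn_coord _) z hz
      rw [vectorField_coord] at h1
      rw [← h1, show V.tau (fun z => z (Sum.inl (i, k))) = fun z => z (Sum.inl (i, k + 1)) from
        vectorField_coord _ _, vectorField_coord]
  · exact .gen _ (Or.inl ⟨Sum.inr j, rfl⟩)

theorem delta_sub_lift_mem (hv : v ∈ V.U) {υ : Der m p} {F : (Coord m p → ℝ) → ℝ}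
    (hF : IsGermAt v F) (h : D.InIdeal v ((fun z => z υ) - lift F)) :
    D.InIdeal v ((fun z => z υ.delta) - lift (D.delta F)) := by
  refine InDiffIdeal.sub_trans (Q := deltaT (lift F)) (.congr _ _ ?_ (.delta _ h))
    (D.vectorField_lift_sub_mem (θ := Der.delta) (fun c => D.delta_toDer_sub_mem hv c) hF)
  filter_upwards [(D.isGermAt_lift hF).choose_spec.eventually] with z hz
  refine (vectorField_sub _ (isGermAt_coord _) hz.isGermAt).trans ?_
  rw [vectorField_coord]
  rfl

/-- Modulo the ideal, every derivative is a function on the ordinary diffiety. -/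
theorem sub_lift_jet_mem (hv : v ∈ V.U) (υ : Der m p) :
    D.InIdeal v ((fun z => z υ) - lift (D.jet υ)) := by
  obtain ⟨i, a, b⟩ := υ
  induction a with
  | zero =>
    induction b with
    | zero =>
      have : lift (D.jet (i, 0, 0)) = fun z => z (i, 0, 0) := by
        rcases i with i | j <;> rfl
      rw [this]; exact InDiffIdeal.sub_self _
    | succ b ih =>
      have := D.delta_sub_lift_mem hv (D.isGermAt_jet hv _) ih
      refine .congr _ _ (.sub .rfl (D.lift_congr ?_)) this
      filter_upwards [V.isOpen.mem_nhds hv] with z hz using D.delta_jet _ hz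
  | succ a ih =>
    have := D.tau_sub_lift_mem (D.isGermAt_jet hv _) ih
    rwa [D.tau_jet] at this

end Symmetry

section

variable {m p : ℕ}

/-! ### Admissible orderings. -/

section Orderings

variable {r : Der m p → Der m p → Prop}

theorem tau_iterate_delta_iterate (a b : ℕ) (υ : Der m p) :
    Der.tau^[a] (Der.delta^[b] υ) = (υ.1, υ.2.1 + a, υ.2.2 + b) := by
  induction a with
  | zero =>
    induction b with
    | zero => rfl
    | succ b ih =>
      rw [Function.iterate_zero_apply] at ih
      rw [Function.iterate_zero_apply, Function.iterate_succ_apply', ih]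
      rfl
  | succ a ih => rw [Function.iterate_succ_apply', ih]; rfl

theorem isDerOf_iff {υ' υ : Der m p} :
    IsDerOf υ' υ ↔ υ.1 = υ'.1 ∧ υ.2.1 ≤ υ'.2.1 ∧ υ.2.2 ≤ υ'.2.2 := by
  constructor
  · rintro ⟨a, b, rfl⟩
    simp [tau_iterate_delta_iterate]
  · rintro ⟨h1, h2, h3⟩
    refine ⟨υ'.2.1 - υ.2.1, υ'.2.2 - υ.2.2, ?_⟩
    rw [tau_iterate_delta_iterate, Nat.add_sub_cancel' h2, Nat.add_sub_cancel' h3, h1]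

theorem IsDerOf.refl (υ : Der m p) : IsDerOf υ υ := ⟨0, 0, rfl⟩

namespace IsAdmissible

variable (hr : IsAdmissible r)
include hr

theorem trans {a b c : Der m p} (h1 : r a b) (h2 : r b c) : r a c :=
  hr.total.toIsStrictOrder.toIsTrans.trans _ _ _ h1 h2

theorem irrefl (a : Der m p) : ¬ r a a := hr.total.toIsStrictOrder.toIrrefl.irrefl a

theorem trichotomy (a b : Der m p) : r a b ∨ a = b ∨ r b a := by
  have := hr.total
  exact trichotomous_of r a b

theorem eq_or_rel_trans {a b c : Der m p} (h1 : a = b ∨ r a b) (h2 : r b c) : r a c := by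
  rcases h1 with rfl | h1
  exacts [h2, hr.trans h1 h2]

theorem eq_or_rel_of_isDerOf {υ' υ : Der m p} (h : IsDerOf υ' υ) : υ = υ' ∨ r υ υ' := by
  obtain ⟨a, b, rfl⟩ := h
  induction a with
  | zero =>
    induction b with
    | zero => exact Or.inl rfl
    | succ b ih =>
      rw [Function.iterate_zero_apply] at ih ⊢
      rw [Function.iterate_succ_apply']
      exact Or.inr (hr.eq_or_rel_trans ih (hr.lt_delta _))
  | succ a ih =>
    rw [Function.iterate_succ_apply']
    exact Or.inr (hr.eq_or_rel_trans ih (hr.lt_tau _))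

/-- Dickson's lemma: in an infinite descending sequence some term would be equal to or a derivative
of an earlier one, hence not smaller. -/
theorem wellFounded : WellFounded r := by
  rw [wellFounded_iff_isEmpty_descending_chain]
  refine ⟨fun ⟨f, hf⟩ => ?_⟩
  have hlt : ∀ i j, i < j → r (f j) (f i) := by
    intro i j hij
    induction hij with
    | refl => exact hf i
    | step _ ih => exact hr.trans (hf _) ih
  obtain ⟨i, j, hij, h⟩ := ((Finite.wellQuasiOrdered (Eq : Var m p → Var m p → Prop)).prod
    (wellQuasiOrdered_le (α := ℕ × ℕ))) f
  rcases hr.eq_or_rel_of_isDerOf (isDerOf_iff.2 ⟨h.1, h.2.1, h.2.2⟩) with h1 | h1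
  · exact hr.irrefl _ (h1 ▸ hlt i j hij)
  · exact hr.irrefl _ (hr.trans h1 (hlt i j hij))

theorem exists_max {S : Finset (Der m p)} (hS : S.Nonempty) :
    ∃ υ ∈ S, ∀ t ∈ S, t = υ ∨ r t υ := by
  induction hS using Finset.Nonempty.cons_induction with
  | singleton a => exact ⟨a, by simp⟩
  | cons a S ha hS ih =>
    obtain ⟨υ, hυ, hmax⟩ := ih
    rcases hr.trichotomy a υ with h | h | h
    · refine ⟨υ, Finset.mem_cons_of_mem hυ, fun t ht => ?_⟩
      rcases Finset.mem_cons.1 ht with rfl | ht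
      exacts [Or.inr h, hmax t ht]
    · exact absurd (h ▸ hυ) ha
    · refine ⟨a, Finset.mem_cons_self a S, fun t ht => ?_⟩
      rcases Finset.mem_cons.1 ht with rfl | ht
      exacts [Or.inl rfl, Or.inr (hr.eq_or_rel_trans (hmax t ht) h)]

theorem isMain_unique {η : Der m p → ℝ} {P : (Der m p → ℝ) → ℝ} {υ υ' : Der m p}
    (h : IsMain η r P υ) (h' : IsMain η r P υ') : υ = υ' := by
  rcases h.2 _ h'.1 with h1 | h1
  · exact h1.symm
  rcases h'.2 _ h.1 with h2 | h2
  · exact h2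
  · exact absurd (hr.trans h1 h2) (hr.irrefl _)

end IsAdmissible

end Orderings

/-! ### Parametric derivatives: absence of relations, reduction, independence. -/

/-- `υ` is not equal to or a derivative of one of the main derivatives in the list of ranks `ρ`. -/
def IsParametric (ρ : List (Der m p × ℕ)) (υ : Der m p) : Prop := ∀ s ∈ ρ, ¬ IsDerOf υ s.1

/-- Cuts a chain at the first rank that fails `q`. With `q` meaning "below `υ`" this prepares the
insertion of a new element with main derivative `υ`. -/
theorem exists_split_forall₂ {α β : Type*} {Q : α → β → Prop} (q : β → Prop) {A : List α}
    {ρ : List β} (h : List.Forall₂ Q A ρ) :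
    ∃ (A₁ : List α) (ρ₁ ρ₂ : List β), ρ = ρ₁ ++ ρ₂ ∧ List.Forall₂ Q A₁ ρ₁ ∧ (∀ P ∈ A₁, P ∈ A) ∧
      (∀ s ∈ ρ₁, q s) ∧ (ρ₂ = [] ∨ ∃ s t, ρ₂ = s :: t ∧ ¬ q s) := by
  induction h with
  | nil => exact ⟨[], [], [], rfl, .nil, by simp, by simp, Or.inl rfl⟩
  | @cons a b A ρ hab h ih =>
    by_cases hb : q b
    · obtain ⟨A₁, ρ₁, ρ₂, h1, h2, h3, h4, h5⟩ := ih
      refine ⟨a :: A₁, b :: ρ₁, ρ₂, by simp [h1], .cons hab h2, ?_, ?_, h5⟩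
      · intro P hP
        rcases List.mem_cons.1 hP with rfl | hP
        exacts [List.mem_cons_self, List.mem_cons_of_mem _ (h3 P hP)]
      · intro s hs
        rcases List.mem_cons.1 hs with rfl | hs
        exacts [hb, h4 s hs]
    · exact ⟨[], [], b :: ρ, rfl, .nil, by simp, by simp, Or.inr ⟨b, ρ, rfl, hb⟩⟩

theorem exists_of_forall₂_right {α β : Type*} {Q : α → β → Prop} {A : List α} {ρ : List β}
    (h : List.Forall₂ Q A ρ) {s : β} (hs : s ∈ ρ) : ∃ P ∈ A, Q P s := by
  induction h with
  | nil => simp at hs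
  | cons hab _ ih =>
    rcases List.mem_cons.1 hs with rfl | hs
    · exact ⟨_, List.mem_cons_self, hab⟩
    · obtain ⟨P, hP, h⟩ := ih hs
      exact ⟨P, List.mem_cons_of_mem _ hP, h⟩

theorem exists_of_forall₂_left {α β : Type*} {Q : α → β → Prop} {A : List α} {ρ : List β}
    (h : List.Forall₂ Q A ρ) {P : α} (hP : P ∈ A) : ∃ s ∈ ρ, Q P s := by
  induction h with
  | nil => simp at hP
  | cons hab _ ih =>
    rcases List.mem_cons.1 hP with rfl | hP
    · exact ⟨_, List.mem_cons_self, hab⟩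
    · obtain ⟨s, hs, h⟩ := ih hP
      exact ⟨s, List.mem_cons_of_mem _ hs, h⟩

/-- A coefficient involves one coordinate fewer than `P`, which feeds the induction on the support
below. -/
theorem coeffAt_analyticNear {η : Der m p → ℝ} {S : Finset (Der m p)} {P : (Der m p → ℝ) → ℝ}
    (hP : AnalyticNear S P η) (υ : Der m p) (k : ℕ) :
    AnalyticNear (S.erase υ) (coeffAt η υ k P) η := by
  have h1 : AnalyticNear (S.erase υ)
      (fun z => (pderiv υ)^[k] P fun s => if s = υ then η υ else z s) η := by
    refine AnalyticNear.comp (G := fun s (z : Der m p → ℝ) => if s = υ then η υ else z s)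
      (S := S) ?_ ?_ ?_
    · have : (fun s => if s = υ then η υ else η s) = η := by
        funext s; split_ifs with h <;> simp [h]
      rw [this]
      exact hP.pderiv_iterate υ k
    · intro s hs
      by_cases h : s = υ
      · simpa [h] using AnalyticNear.const _
      · simpa [h] using AnalyticNear.coord (Finset.mem_erase.2 ⟨h, hs⟩)
    · intro s
      by_cases h : s = υ
      · simpa [h] using continuousAt_const
      · simpa [h] using (continuous_apply s).continuousAt
  refine (h1.mul (.const (k.factorial : ℝ)⁻¹)).congr (.of_eq (funext fun z => ?_))
  simp only [Pi.mul_apply, coeffAt, div_eq_mul_inv]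
  refine congrArg (fun w => (pderiv υ)^[k] P w * _) (funext fun s => ?_)
  by_cases h : s = υ
  · subst h; simp
  · simp [h]

namespace Symmetry

variable {V : OrdDiffiety m p} (D : Symmetry V) {v : Coord m p → ℝ}
  {r : Der m p → Der m p → Prop} {A : List ((Der m p → ℝ) → ℝ)} {ρ : List (Der m p × ℕ)}

/-- A germ in the ideal that depends on parametric derivatives only vanishes. -/
theorem eventuallyEq_zero_of_parametric (hv : v ∈ V.U) (hr : IsAdmissible r)
    (hch : IsChainOf (D.point v) r (D.InIdeal v) A ρ)
    (hmin : ∀ A' ρ', IsChainOf (D.point v) r (D.InIdeal v) A' ρ' → ¬ RanksLT r ρ' ρ)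
    (S : Finset (Der m p)) (hS : ∀ s ∈ S, IsParametric ρ s) {P : (Der m p → ℝ) → ℝ}
    (hP : AnalyticNear S P (D.point v)) (hI : D.InIdeal v P) : P =ᶠ[𝓝 (D.point v)] 0 := by
  induction S using Finset.strongInduction generalizing P with
  | H S ih =>
  -- Once idle coordinates are discarded, the largest element of `S` is the main derivative of `P`.
  by_cases hdep : ∃ s ∈ S, SameGerm (D.point v) (pderiv s P) 0
  · obtain ⟨s, hs, h0⟩ := hdep
    exact ih _ (Finset.erase_ssubset hs) (fun t ht => hS t (Finset.mem_of_mem_erase ht))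
      (hP.erase h0) hI
  push Not at hdep
  -- With empty support `P` is constant near the point, and elements of the ideal vanish there.
  rcases S.eq_empty_or_nonempty with rfl | hne
  · obtain ⟨g, -, e⟩ := hP
    have h0 : P (D.point v) = 0 := (hI.vanish D hv).2.eq_of_nhds
    filter_upwards [e] with z hz
    rw [hz, Pi.zero_apply, ← h0, e.eq_of_nhds]
    exact congrArg g (Subsingleton.elim _ _)
  obtain ⟨υ, hυ, hmax⟩ := hr.exists_max hne
  have hmain : IsMain (D.point v) r P υ := by
    refine ⟨hdep υ hυ, fun υ' h' => hmax υ' ?_⟩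
    by_contra hn
    exact h' (by filter_upwards [hP.eventually] with z hz using hz.pderiv_eq_zero hn)
  by_contra hne0
  have hex : {k : ℕ | ¬ SameGerm (D.point v) (coeffAt (D.point v) υ k P) 0}.Nonempty := by
    by_contra hemp
    rw [Set.not_nonempty_iff_eq_empty, Set.eq_empty_iff_forall_notMem] at hemp
    refine hne0 (hP.eventuallyEq_zero_of_iterate (c := υ) fun k => ?_)
    have h1 : SameGerm (D.point v) (coeffAt (D.point v) υ k P) 0 := not_not.1 (hemp k)
    filter_upwards [h1] with z hz
    simp only [coeffAt, Pi.zero_apply, div_eq_zero_iff] at hz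
    exact hz.resolve_right (by exact_mod_cast k.factorial_ne_zero)
  have hd : ¬ SameGerm (D.point v) (coeffAt (D.point v) υ (degreeIn (D.point v) υ P) P) 0 :=
    Nat.sInf_mem hex
  -- The initial is a nonzero germ in fewer parametric derivatives, so by induction it is not in the
  -- ideal.
  have hinit : ¬ D.InIdeal v (coeffAt (D.point v) υ (degreeIn (D.point v) υ P) P) := fun h =>
    hd (ih _ (Finset.erase_ssubset hυ) (fun t ht => hS t (Finset.mem_of_mem_erase ht))
      (coeffAt_analyticNear hP υ _) h)
  -- Keeping the elements below `υ` and appending `P` gives a chain of lower rank: either it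
  -- continues the whole chain, or the first discarded main derivative, which differs from the
  -- parametric `υ`, is larger than `υ`.
  obtain ⟨A₁, ρ₁, ρ₂, h1, h2, h3, h4, h5⟩ := exists_split_forall₂ (fun s => r s.1 υ) hch.2.1
  have hmem : ∀ s ∈ ρ₁, s ∈ ρ := fun s hs => h1 ▸ List.mem_append_left _ hs
  refine hmin (A₁ ++ [P]) (ρ₁ ++ [(υ, degreeIn (D.point v) υ P)]) ⟨?_, ?_, ?_⟩ ?_
  · intro Q hQ
    rcases List.mem_append.1 hQ with hQ | hQ
    · exact hch.1 Q (h3 Q hQ)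
    · rw [List.mem_singleton.1 hQ]; exact hI
  · exact List.rel_append h2 (.cons ⟨⟨hmain, rfl⟩, hinit⟩ .nil)
  · refine List.pairwise_append.2 ⟨?_, List.pairwise_singleton _ _, ?_⟩
    · have := hch.2.2
      rw [h1] at this
      exact (List.pairwise_append.1 this).1
    · intro s hs t ht
      rw [List.mem_singleton.1 ht]
      refine ⟨h4 s hs, hS υ hυ s (hmem s hs), fun hder => ?_⟩
      exact hr.irrefl _ (hr.eq_or_rel_trans (hr.eq_or_rel_of_isDerOf hder) (h4 s hs))
  · rcases h5 with rfl | ⟨s, t, rfl, hs⟩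
    · right
      rw [h1]
      simp
    · left
      refine ⟨ρ₁, [], t, (υ, degreeIn (D.point v) υ P), s, rfl, h1, Or.inl ?_⟩
      rcases hr.trichotomy s.1 υ with h | h | h
      · exact absurd h hs
      · exact absurd (h ▸ IsDerOf.refl _) (hS υ hυ s (h1 ▸ by simp))
      · exact h

section Reduction

variable (hr : IsAdmissible r)
  (hch : IsChainOf (D.point v) r (D.InIdeal v) A ρ) (hsolved : IsSolved (D.point v) r A)
include hr hch hsolved

/-- If `R` depended on some `c` not below the main derivative, so would `υ - R`, against maximality;
such coordinates can be removed from the support of `R`. -/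
theorem exists_relation_of_mem {s : Der m p × ℕ} (hs : s ∈ ρ) :
    ∃ (R : (Der m p → ℝ) → ℝ) (T : Finset (Der m p)), (∀ t ∈ T, r t s.1) ∧
      AnalyticNear T R (D.point v) ∧ D.InIdeal v ((fun z => z s.1) - R) := by
  classical
  obtain ⟨P, hPA, ⟨hmain, -⟩, -⟩ := exists_of_forall₂_right hch.2.1 hs
  obtain ⟨υ, R, hυ, ⟨S, hS⟩, hR, hPR⟩ := hsolved P hPA
  obtain rfl := hr.isMain_unique hυ hmain
  refine ⟨R, S.filter fun t => r t s.1, fun t ht => (Finset.mem_filter.1 ht).2, ?_,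
    .congr _ _ hPR (hch.1 P hPA)⟩
  refine hS.filter fun c _ hc => ?_
  by_contra hdep
  have hne : c ≠ s.1 := fun h => hR (h ▸ hdep)
  have hcP : DependsOn (D.point v) P c := by
    intro h0
    refine hdep ?_
    filter_upwards [h0, pderiv_congr c hPR, hS.eventually] with z h1 h2 h3
    have h4 := pderiv_sub (isGermAt_coord s.1) h3.isGermAt c
    rw [h1] at h2
    have h5 : pderiv c (fun z => z s.1 - R z) z = pderiv c (fun z => z s.1) z - pderiv c R z := h4
    rw [h5, pderiv_coord, if_neg hne] at h2
    simpa using h2.symm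
  rcases hυ.2 c hcP with h | h
  exacts [hne h, hc h]

theorem exists_relation {υ : Der m p} (hυ : ¬ IsParametric ρ υ) :
    ∃ (R : (Der m p → ℝ) → ℝ) (T : Finset (Der m p)), (∀ t ∈ T, r t υ) ∧
      AnalyticNear T R (D.point v) ∧ D.InIdeal v ((fun z => z υ) - R) := by
  simp only [IsParametric, not_forall, not_not] at hυ
  obtain ⟨s, hs, a, b, rfl⟩ := hυ
  -- Differentiating `υ - R` gives `θυ` minus a function of the variables `t` and `θt` of `R`, all
  -- below `θυ` by admissibility.
  have key : ∀ (θ : Der m p → Der m p) (Dv : ((Der m p → ℝ) → ℝ) → (Der m p → ℝ) → ℝ),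
      (Dv = vectorField fun υ z => z (θ υ)) → (∀ P, D.InIdeal v P → D.InIdeal v (Dv P)) →
      (∀ υ, r υ (θ υ)) → (∀ υ₁ υ₂, r υ₁ υ₂ → r (θ υ₁) (θ υ₂)) → ∀ υ,
      (∃ (R : (Der m p → ℝ) → ℝ) (T : Finset (Der m p)), (∀ t ∈ T, r t υ) ∧
        AnalyticNear T R (D.point v) ∧ D.InIdeal v ((fun z => z υ) - R)) →
      ∃ (R : (Der m p → ℝ) → ℝ) (T : Finset (Der m p)), (∀ t ∈ T, r t (θ υ)) ∧
        AnalyticNear T R (D.point v) ∧ D.InIdeal v ((fun z => z (θ υ)) - R) := by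
    rintro θ Dv rfl hI hlt hmono υ ⟨R, T, hT, hR, hmem⟩
    refine ⟨vectorField (fun υ z => z (θ υ)) R, T ∪ T.image θ, ?_,
      hR.vectorField Finset.subset_union_left fun c hc => .coord
        (Finset.mem_union_right _ (Finset.mem_image_of_mem θ hc)), .congr _ _ ?_ (hI _ hmem)⟩
    · intro t ht
      rcases Finset.mem_union.1 ht with ht | ht
      · exact hr.trans (hT t ht) (hlt υ)
      · obtain ⟨t', ht', rfl⟩ := Finset.mem_image.1 ht
        exact hmono _ _ (hT t' ht')
    · filter_upwards [hR.eventually] with z hz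
      refine (vectorField_sub _ (isGermAt_coord _) hz.isGermAt).trans ?_
      rw [vectorField_coord]
      rfl
  induction a with
  | zero =>
    induction b with
    | zero => exact D.exists_relation_of_mem hr hch hsolved hs
    | succ b ih =>
      rw [Function.iterate_zero_apply] at ih ⊢
      rw [Function.iterate_succ_apply']
      exact key Der.delta deltaT rfl (fun P => .delta P) hr.lt_delta
        (fun _ _ => (hr.delta_iff _ _).2) _ ih
  | succ a ih =>
    rw [Function.iterate_succ_apply']
    exact key Der.tau tauT rfl (fun P => .tau P) hr.lt_tau (fun _ _ => (hr.tau_iff _ _).2) _ ih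

/-- Modulo the ideal, every derivative is a function of lower parametric derivatives. -/
theorem exists_reduction (hv : v ∈ V.U) (υ : Der m p) :
    ∃ (R : (Der m p → ℝ) → ℝ) (T : Finset (Der m p)),
      (∀ t ∈ T, IsParametric ρ t ∧ (t = υ ∨ r t υ)) ∧
      AnalyticNear T R (D.point v) ∧ D.InIdeal v ((fun z => z υ) - R) := by
  classical
  induction υ using hr.wellFounded.induction with
  | h υ ih =>
  by_cases hυ : IsParametric ρ υ
  · exact ⟨fun z => z υ, {υ}, by simpa using hυ, .coord (Finset.mem_singleton_self υ),
      .sub_self _⟩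
  obtain ⟨R₀, T₀, hT₀, hR₀, hI₀⟩ := D.exists_relation hr hch hsolved hυ
  choose! R T hT hR hI using ih
  -- Each lower derivative in the relation for `υ` is replaced by its own reduction.
  let H : Der m p → (Der m p → ℝ) → ℝ := fun t => if t ∈ T₀ then R t else fun z => z t
  have hH : ∀ t, IsGermAt (D.point v) (H t) := by
    intro t
    by_cases ht : t ∈ T₀
    · simpa [H, ht] using (hR t (hT₀ t ht)).isGermAt
    · simpa [H, ht] using isGermAt_coord t
  have hHI : ∀ t, D.InIdeal v ((fun z => z t) - H t) := by
    intro t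
    by_cases ht : t ∈ T₀
    · simpa [H, ht] using hI t (hT₀ t ht)
    · simp only [H, ht, if_false]; exact InDiffIdeal.sub_self _
  have hHη : ∀ t, D.point v t = H t (D.point v) := fun t =>
    sub_eq_zero.1 ((hHI t).vanish D hv).2.eq_of_nhds
  refine ⟨fun z => R₀ fun t => H t z, T₀.biUnion T, ?_, ?_, ?_⟩
  · intro t ht
    obtain ⟨s, hs, hts⟩ := Finset.mem_biUnion.1 ht
    have := hT s (hT₀ s hs) t hts
    exact ⟨this.1, Or.inr (hr.eq_or_rel_trans this.2 (hT₀ s hs))⟩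
  · refine AnalyticNear.comp (S := T₀) ?_ (fun s hs => ?_) fun t => (hH t).continuousAt
    · rw [← funext hHη]; exact hR₀
    · simp only [H, hs, if_true]
      exact (hR s (hT₀ s hs)).mono (Finset.subset_biUnion_of_mem T hs)
  · exact hI₀.sub_trans (InDiffIdeal.comp_sub_comp (G := fun t z => z t) (H := H) hR₀.isGermAt
      (fun t => isGermAt_coord t) hH hHη hHI)

end Reduction

/-- The differentials of the parametric derivatives are linearly independent. -/
theorem parametric_independent (hv : v ∈ V.U) (hr : IsAdmissible r)
    (hch : IsChainOf (D.point v) r (D.InIdeal v) A ρ)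
    (hmin : ∀ A' ρ', IsChainOf (D.point v) r (D.InIdeal v) A' ρ' → ¬ RanksLT r ρ' ρ)
    (hsolved : IsSolved (D.point v) r A)
    {T : Finset (Der m p)} (hT : ∀ t ∈ T, IsParametric ρ t) {g : Der m p → ℝ}
    (hg : ∀ c, ∑ υ ∈ T, g υ * pderiv c (D.jet υ) v = 0) : ∀ υ ∈ T, g υ = 0 := by
  classical
  choose R S hS hR hI using fun c : Coord m p => D.exists_reduction hr hch hsolved hv c.toDer
  have hRη : ∀ c : Coord m p, D.point v c.toDer = R c (D.point v) := fun c =>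
    sub_eq_zero.1 ((hI c).vanish D hv).2.eq_of_nhds
  have hRv : (fun c => R c (D.point v)) = v := by rw [← funext hRη, D.point_toDer]
  have hjet : ∀ υ, IsGermAt (fun c => R c (D.point v)) (D.jet υ) := fun υ => by
    rw [hRv]; exact D.isGermAt_jet hv υ
  -- Writing each coordinate `c` as `R c` in parametric derivatives and substituting into `jet υ`
  -- returns `υ` itself: the difference lies in the ideal and involves parametric derivatives only.
  have hQ : ∀ υ, IsParametric ρ υ →
      (fun z => D.jet υ fun c => R c z) =ᶠ[𝓝 (D.point v)] fun z => z υ := by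
    intro υ hυ
    have h1 := (D.sub_lift_jet_mem hv υ).sub_trans (InDiffIdeal.comp_sub_comp
      (G := fun (c : Coord m p) (z : Der m p → ℝ) => z c.toDer) (H := R)
      (by rw [D.point_toDer]; exact D.isGermAt_jet hv υ) (fun _ => isGermAt_coord _)
      (fun c => (hR c).isGermAt) hRη hI)
    obtain ⟨C, hC⟩ := hjet υ
    have h2 : AnalyticNear (C.biUnion S) (fun z => D.jet υ fun c => R c z) (D.point v) :=
      hC.comp (fun c hc => (hR c).mono (Finset.subset_biUnion_of_mem S hc))
        fun c => (hR c).continuousAt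
    have h3 : AnalyticNear (insert υ (C.biUnion S))
        ((fun z => z υ) - fun z => D.jet υ fun c => R c z) (D.point v) :=
      (AnalyticNear.coord (Finset.mem_insert_self _ _)).sub (h2.mono (Finset.subset_insert _ _))
    have h4 := D.eventuallyEq_zero_of_parametric hv hr hch hmin _ (fun t ht => by
      rcases Finset.mem_insert.1 ht with rfl | ht
      · exact hυ
      · obtain ⟨c, _, hc⟩ := Finset.mem_biUnion.1 ht
        exact (hS c t hc).1) h3 h1
    filter_upwards [h4] with z hz
    exact (sub_eq_zero.1 hz).symm
  obtain ⟨C, hC⟩ := exists_common_support T fun υ _ => hjet υ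
  intro υ' hυ'
  -- Differentiating this identity shows that the Jacobian matrix of the parametric jets has a
  -- one-sided inverse, which gives independence.
  have h1 : ∀ υ ∈ T, ∑ c ∈ C, pderiv c (D.jet υ) v * pderiv υ' (R c) (D.point v) =
      if υ' = υ then 1 else 0 := by
    intro υ hυ
    have h2 := pderiv_comp (hC υ hυ) (fun c => (hR c).isGermAt) υ'
    rw [pderiv_congr_at υ' (hQ υ (hT υ hυ)), pderiv_coord] at h2
    simp only [hRv] at h2
    exact h2.symm
  have h2 : ∑ υ ∈ T, g υ * (if υ' = υ then 1 else 0) = 0 := by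
    rw [Finset.sum_congr rfl fun υ hυ => by rw [← h1 υ hυ, Finset.mul_sum], Finset.sum_comm]
    refine Finset.sum_eq_zero fun c _ => ?_
    rw [Finset.sum_congr rfl fun υ _ => (mul_assoc _ _ _).symm, ← Finset.sum_mul, hg c, zero_mul]
  simpa [hυ'] using h2

end Symmetry

end

/-! ### Orders, and generation of coordinates by jets. -/

section

variable {m p : ℕ}

/-- The coordinates of order at most `N`. -/
def coordsLE (m p N : ℕ) : Finset (Coord m p) :=
  (Finset.univ ×ˢ Finset.range (N + 1)).disjSum Finset.univ

theorem mem_coordsLE {N : ℕ} {c : Coord m p} : c ∈ coordsLE m p N ↔ c.order ≤ N := by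
  rcases c with ⟨i, k⟩ | j
  · simp [coordsLE, Coord.order]
  · simp [coordsLE, Coord.order]

theorem card_coordsLE (N : ℕ) : (coordsLE m p N).card = m * (N + 1) + p := by
  simp [coordsLE]

theorem coordsLE_mono {N N' : ℕ} (h : N ≤ N') : coordsLE m p N ⊆ coordsLE m p N' := fun _ hc =>
  mem_coordsLE.2 ((mem_coordsLE.1 hc).trans h)

theorem IsGermAt.exists_coordsLE {F : (Coord m p → ℝ) → ℝ} {v : Coord m p → ℝ}
    (hF : IsGermAt v F) : ∃ N, AnalyticNear (coordsLE m p N) F v := by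
  obtain ⟨S, hS⟩ := hF
  exact ⟨S.sup Coord.order, hS.mono fun c hc => mem_coordsLE.2 (Finset.le_sup hc)⟩

theorem ordTau_le_iff {U : Set (Coord m p → ℝ)} {F : (Coord m p → ℝ) → ℝ} {N : ℕ} :
    ordTau U F ≤ N ↔ ∀ c : Coord m p, N < c.order → ∀ z ∈ U, pderiv c F z = 0 := by
  simp only [ordTau, iSup_le_iff]
  refine forall_congr' fun c => ⟨fun h hc z hz => ?_, fun h hz => ?_⟩
  · by_contra hne
    exact absurd (Nat.cast_le.1 (h ⟨z, hz, hne⟩)) (not_le.2 hc)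
  · obtain ⟨z, hz, hne⟩ := hz
    exact Nat.cast_le.2 (not_lt.1 fun hc => hne (h hc z hz))

theorem iInf_natCast_le {q : ℕ → Prop} {b : ℕ} (h : q b) : (⨅ (b : ℕ) (_ : q b), (b : ℕ∞)) ≤ b :=
  iInf₂_le b h

theorem exists_of_iInf_natCast_ne_top {q : ℕ → Prop} (h : (⨅ (b : ℕ) (_ : q b), (b : ℕ∞)) ≠ ⊤) :
    ∃ b, q b ∧ (⨅ (b : ℕ) (_ : q b), (b : ℕ∞)) = b := by
  classical
  have hex : ∃ b, q b := by
    by_contra hn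
    push Not at hn
    exact h (by simp [hn])
  refine ⟨Nat.find hex, Nat.find_spec hex, le_antisymm (iInf_natCast_le (Nat.find_spec hex)) ?_⟩
  exact le_iInf₂ fun b hb => Nat.cast_le.2 (Nat.find_min' hex hb)

/-- The derivatives `τ^a δ^b x_i` with `a < k i` and `b < l i`. -/
def box (k l : Var m p → ℕ) : Finset (Der m p) :=
  (Finset.univ.sigma fun i => Finset.range (k i) ×ˢ Finset.range (l i)).map
    (Equiv.sigmaEquivProd (Var m p) (ℕ × ℕ)).toEmbedding

theorem mem_box {k l : Var m p → ℕ} {υ : Der m p} :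
    υ ∈ box k l ↔ υ.2.1 < k υ.1 ∧ υ.2.2 < l υ.1 := by
  obtain ⟨i, a, b⟩ := υ
  simp only [box, Finset.mem_map_equiv, Finset.mem_sigma, Finset.mem_univ, true_and,
    Finset.mem_product, Finset.mem_range]
  rfl

theorem card_box (k l : Var m p → ℕ) : (box k l).card = ∑ i, k i * l i := by
  simp [box]

namespace IsParametric

variable {ρ : List (Der m p × ℕ)}

theorem of_isDerOf {υ υ' : Der m p} (h : IsDerOf υ' υ) (hυ : IsParametric ρ υ') :
    IsParametric ρ υ := fun s hs hder => hυ s hs (by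
  rw [isDerOf_iff] at *
  exact ⟨hder.1.trans h.1, hder.2.1.trans h.2.1, hder.2.2.trans h.2.2⟩)

end IsParametric

namespace OrdDiffiety

variable (V : OrdDiffiety m p) {v : Coord m p → ℝ}

theorem analyticNear_tau (hv : v ∈ V.U) {F : (Coord m p → ℝ) → ℝ} {N : ℕ}
    (hF : AnalyticNear (coordsLE m p N) F v) :
    AnalyticNear (coordsLE m p (N + 1)) (V.tau F) v := by
  refine hF.vectorField (coordsLE_mono N.le_succ) fun c hc => ?_
  rcases c with ⟨i, k⟩ | j
  · exact .coord (mem_coordsLE.2 (Nat.succ_le_succ (mem_coordsLE.1 hc)))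
  -- The support of `f_j` may contain coordinates of order above `1`; the corresponding partial
  -- derivatives vanish on `U`, so they can be filtered out.
  · obtain ⟨S, hS⟩ := V.f_analytic j
    refine ((hS v hv).filter (p := fun c : Coord m p => c.order ≤ 1) fun c _ hc => ?_).mono
      fun c hc => mem_coordsLE.2 ((Finset.mem_filter.1 hc).2.trans (by omega))
    filter_upwards [V.isOpen.mem_nhds hv] with z hz
    exact ordTau_le_iff.1 (by exact_mod_cast V.f_order j) c (not_le.1 hc) z hz

end OrdDiffiety

namespace Symmetry

variable {V : OrdDiffiety m p} (D : Symmetry V) {v : Coord m p → ℝ}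

/-- The offset `N` does not depend on `a`: along a column the order grows with slope at most one. -/
theorem exists_analyticNear_jet_tau (hv : v ∈ V.U) (υ : Der m p) :
    ∃ N, ∀ a, AnalyticNear (coordsLE m p (a + N)) (D.jet (υ.1, υ.2.1 + a, υ.2.2)) v := by
  obtain ⟨N, hN⟩ := (D.isGermAt_jet hv υ).exists_coordsLE
  refine ⟨N, fun a => ?_⟩
  induction a with
  | zero => simpa using hN
  | succ a ih =>
    have h := V.analyticNear_tau hv ih
    rw [D.tau_jet] at h
    rwa [Nat.add_right_comm]

/-- Near `v`, `F` is an analytic function of functions `τ^a δ^b x_i` with `(i, a, b) ∈ K`. -/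
def FunctionOf (v : Coord m p → ℝ) (K : Set (Der m p)) (F : (Coord m p → ℝ) → ℝ) : Prop :=
  ∃ (g : (Der m p → ℝ) → ℝ) (T : Finset (Der m p)), ↑T ⊆ K ∧ AnalyticNear T g (D.point v) ∧
    F =ᶠ[𝓝 v] fun z => g (D.point z)

namespace FunctionOf

variable {D} {K K' : Set (Der m p)} {F G : (Coord m p → ℝ) → ℝ}

theorem mono (h : D.FunctionOf v K F) (hK : K ⊆ K') : D.FunctionOf v K' F := by
  obtain ⟨g, T, hT, h⟩ := h
  exact ⟨g, T, hT.trans hK, h⟩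

theorem congr (h : D.FunctionOf v K F) (e : F =ᶠ[𝓝 v] G) : D.FunctionOf v K G := by
  obtain ⟨g, T, hT, hg, h⟩ := h
  exact ⟨g, T, hT, hg, e.symm.trans h⟩

theorem jet {υ : Der m p} (h : υ ∈ K) : D.FunctionOf v K (D.jet υ) :=
  ⟨fun z => z υ, {υ}, by simpa using h, .coord (Finset.mem_singleton_self υ), .rfl⟩

theorem sum_mul {ι : Type*} {s : Finset ι} {F G : ι → (Coord m p → ℝ) → ℝ}
    (hF : ∀ i ∈ s, D.FunctionOf v K (F i)) (hG : ∀ i ∈ s, D.FunctionOf v K (G i)) :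
    D.FunctionOf v K fun z => ∑ i ∈ s, F i z * G i z := by
  classical
  choose! f S hS hf hFf using hF
  choose! g T hT hg hGg using hG
  refine ⟨fun w => ∑ i ∈ s, (f i * g i) w, s.biUnion fun i => S i ∪ T i, ?_,
    AnalyticNear.sum fun i hi => ?_, ?_⟩
  · intro t ht
    obtain ⟨i, hi, ht⟩ := Finset.mem_biUnion.1 (Finset.mem_coe.1 ht)
    rcases Finset.mem_union.1 ht with ht | ht
    exacts [hS i hi ht, hT i hi ht]
  · have := Finset.subset_biUnion_of_mem (fun i => S i ∪ T i) hi
    exact ((hf i hi).mono (Finset.subset_union_left.trans this)).mul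
      ((hg i hi).mono (Finset.subset_union_right.trans this))
  · filter_upwards [(Finset.eventually_all s).2 hFf, (Finset.eventually_all s).2 hGg] with z h1 h2
    exact Finset.sum_congr rfl fun i hi => by rw [h1 i hi, h2 i hi]; rfl

theorem vectorField_mem (hv : v ∈ V.U) {b : Coord m p → (Coord m p → ℝ) → ℝ}
    (hF : D.FunctionOf v K F) (hK : K ⊆ K')
    (h : ∀ υ ∈ K, D.FunctionOf v K' (vectorField b (D.jet υ))) :
    D.FunctionOf v K' (vectorField b F) := by
  obtain ⟨g, T, hT, hg, e⟩ := hF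
  refine (sum_mul (s := T) (F := fun t z => pderiv t g (D.point z))
    (G := fun t => vectorField b (D.jet t)) (fun t _ => ⟨_, T, hT.trans hK, hg.pderiv t, .rfl⟩)
    fun t ht => h t (hT ht)).congr (EventuallyEq.trans ?_ (vectorField_congr b e.symm))
  filter_upwards [(D.tendsto_point hv).eventually hg.eventually, V.isOpen.mem_nhds hv] with z hz hzU
  exact (vectorField_comp b (G := D.jet) hz fun υ => D.isGermAt_jet hzU υ).symm

theorem pderiv_eq_sum (hv : v ∈ V.U) (hF : D.FunctionOf v K F) :
    ∃ (w : Der m p → ℝ) (T : Finset (Der m p)), ↑T ⊆ K ∧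
      ∀ c, pderiv c F v = ∑ t ∈ T, w t * pderiv c (D.jet t) v := by
  obtain ⟨g, T, hT, hg, e⟩ := hF
  refine ⟨fun t => pderiv t g (D.point v), T, hT, fun c => ?_⟩
  rw [pderiv_congr_at c e]
  exact pderiv_comp (G := D.jet) hg (fun υ => D.isGermAt_jet hv υ) c

theorem analyticNear (hv : v ∈ V.U) (hF : D.FunctionOf v K F) {S : Finset (Coord m p)}
    (h : ∀ υ ∈ K, AnalyticNear S (D.jet υ) v) : AnalyticNear S F v := by
  obtain ⟨g, T, hT, hg, e⟩ := hF
  exact (AnalyticNear.comp (G := D.jet) hg (fun s hs => h s (hT hs))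
    fun υ => (D.isGermAt_jet hv υ).continuousAt).congr e.symm

/-- The differentials of the jets in `Y`, restricted to coordinates of order at most `N`, span a
space of dimension `m(N+1)+p`. -/
theorem span_card_le (hv : v ∈ V.U) {Y : Finset (Der m p)} {N : ℕ}
    (h : ∀ c ∈ coordsLE m p N, D.FunctionOf v ↑Y fun z => z c) : m * (N + 1) + p ≤ Y.card := by
  classical
  let w : Der m p → coordsLE m p N → ℝ := fun t c => pderiv (c : Coord m p) (D.jet t) v
  have hspan : Submodule.span ℝ (↑(Y.image w) : Set (coordsLE m p N → ℝ)) = ⊤ := by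
    rw [eq_top_iff, ← (Pi.basisFun ℝ (coordsLE m p N)).span_eq, Submodule.span_le]
    rintro _ ⟨c, rfl⟩
    obtain ⟨q, T, hT, hq⟩ := (h c c.2).pderiv_eq_sum hv
    have : Pi.basisFun ℝ (coordsLE m p N) c = ∑ t ∈ T, q t • w t := by
      funext d
      have := hq d
      rw [pderiv_coord] at this
      simp only [Pi.basisFun_apply, Finset.sum_apply, Pi.smul_apply, smul_eq_mul, w, ← this,
        Pi.single_apply, Subtype.ext_iff]
    rw [this]
    exact Submodule.sum_mem _ fun t ht => Submodule.smul_mem _ _ (Submodule.subset_span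
      (Finset.mem_coe.2 (Finset.mem_image_of_mem w (hT ht))))
  have h1 := finrank_span_finset_le_card (R := ℝ) (Y.image w)
  rw [Set.finrank, hspan, finrank_top, Module.finrank_fintype_fun_eq_card, Fintype.card_coe,
    card_coordsLE] at h1
  exact h1.trans Finset.card_image_le

end FunctionOf

/-! ### Upper bounds from independence. -/

section Counting

variable {Par : Der m p → Prop}
  (hind : ∀ (T : Finset (Der m p)) (g : Der m p → ℝ), (∀ t ∈ T, Par t) →
    (∀ c, ∑ υ ∈ T, g υ * pderiv c (D.jet υ) v = 0) → ∀ υ ∈ T, g υ = 0)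
include hind

theorem card_le_of_independent {T : Finset (Der m p)} (hT : ∀ t ∈ T, Par t) {N : ℕ}
    (hN : ∀ t ∈ T, ∀ c : Coord m p, N < c.order → pderiv c (D.jet t) v = 0) :
    T.card ≤ m * (N + 1) + p := by
  have h : LinearIndependent ℝ fun (t : T) (c : coordsLE m p N) =>
      pderiv (c : Coord m p) (D.jet t) v := by
    rw [Fintype.linearIndependent_iff]
    intro g hg t
    classical
    have := hind T (fun υ => if h : υ ∈ T then g ⟨υ, h⟩ else 0) hT (fun c => ?_) t t.2
    · simpa using this
    · by_cases hc : c ∈ coordsLE m p N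
      · have h1 := congrFun hg ⟨c, hc⟩
        simp only [Finset.sum_apply, Pi.smul_apply, smul_eq_mul, Pi.zero_apply] at h1
        rw [← Finset.sum_coe_sort, ← h1]
        exact Finset.sum_congr rfl fun t _ => by simp
      · refine Finset.sum_eq_zero fun t ht => ?_
        rw [hN t ht c (not_le.1 fun h => hc (mem_coordsLE.2 h)), mul_zero]
  have := h.fintype_card_le_finrank
  rwa [Module.finrank_fintype_fun_eq_card, Fintype.card_coe, Fintype.card_coe,
    card_coordsLE] at this

/-- The essential point is that `C` is chosen before `E`: it depends on the columns alone, and the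
orders of the finitely many extra elements are absorbed by taking `k` large. -/
theorem columns_card_le (hv : v ∈ V.U) {l : Var m p → ℕ}
    (hl : ∀ i a b, b < l i → Par (i, a, b)) :
    ∃ C, ∀ E : Finset (Der m p), (∀ υ ∈ E, Par υ ∧ l υ.1 ≤ υ.2.2) → ∃ k₀, ∀ k ≥ k₀,
      k * ∑ i, l i + E.card ≤ m * (k + C + 1) + p := by
  classical
  choose N hN using D.exists_analyticNear_jet_tau hv
  -- `box (fun _ => 1) l` is the set of feet `δ^b x_i` of the columns.
  refine ⟨(box (fun _ => 1) l).sup N, fun E hE => ⟨E.sup N, fun k hk => ?_⟩⟩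
  have hdisj : Disjoint (box (fun _ => k) l) E := by
    rw [Finset.disjoint_left]
    intro υ h1 h2
    exact absurd (mem_box.1 h1).2 (not_lt.2 (hE υ h2).2)
  have hcard : k * ∑ i, l i + E.card = (box (fun _ => k) l ∪ E).card := by
    rw [Finset.card_union_of_disjoint hdisj, card_box, Finset.mul_sum]
  rw [hcard]
  refine D.card_le_of_independent hind (fun t ht => ?_) fun t ht c hc => ?_
  · rcases Finset.mem_union.1 ht with ht | ht
    · exact hl _ _ _ (mem_box.1 ht).2
    · exact (hE t ht).1
  · rcases Finset.mem_union.1 ht with ht | ht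
    · have h1 := mem_box.1 ht
      have h2 := hN (t.1, 0, t.2.2) t.2.1
      simp only [zero_add] at h2
      refine h2.pderiv_eq_zero fun h => ?_
      have h3 := mem_coordsLE.1 h
      have h4 : N (t.1, 0, t.2.2) ≤ (box (fun _ => 1) l).sup N :=
        Finset.le_sup (mem_box.2 ⟨Nat.one_pos, h1.2⟩)
      omega
    · have h2 := hN t 0
      simp only [zero_add, add_zero] at h2
      refine h2.pderiv_eq_zero fun h => ?_
      have h3 := mem_coordsLE.1 h
      have h4 : N t ≤ E.sup N := Finset.le_sup ht
      omega

variable {β : Var m p → ℕ∞} (hβ : ∀ i a (b : ℕ), (b : ℕ∞) < β i → Par (i, a, b))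
include hβ

theorem sum_chimney_le (hv : v ∈ V.U) : ∑ i, β i ≤ m := by
  by_contra hlt
  rw [not_le] at hlt
  -- Truncation at `m + 1` makes infinite chimneys finite and still leaves a sum exceeding `m`.
  let l : Var m p → ℕ := fun i => (min (β i) ((m + 1 : ℕ) : ℕ∞)).toNat
  have hl : ∀ i, (l i : ℕ∞) = min (β i) ((m + 1 : ℕ) : ℕ∞) := fun i =>
    ENat.natCast_toNat (ne_top_of_le_ne_top (ENat.natCast_ne_top (m + 1)) (min_le_right _ _))
  have hsum : m + 1 ≤ ∑ i, l i := by
    by_cases hex : ∃ i, ((m + 1 : ℕ) : ℕ∞) ≤ β i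
    · obtain ⟨i, hi⟩ := hex
      have h1 := hl i
      rw [min_eq_right hi] at h1
      have h2 : l i = m + 1 := by exact_mod_cast h1
      exact h2 ▸ Finset.single_le_sum (fun _ _ => Nat.zero_le _) (Finset.mem_univ i)
    · push Not at hex
      have h1 : ((∑ i, l i : ℕ) : ℕ∞) = ∑ i, β i := by
        rw [Nat.cast_sum]
        exact Finset.sum_congr rfl fun i _ => by rw [hl i, min_eq_left (hex i).le]
      rw [← h1] at hlt
      exact_mod_cast hlt
  obtain ⟨C, hC⟩ := D.columns_card_le hind hv (l := l) fun i a b hb => hβ i a b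
    (lt_of_lt_of_le (Nat.cast_lt.2 hb) ((hl i).le.trans (min_le_left _ _)))
  obtain ⟨k₀, hk⟩ := hC ∅ (by simp)
  -- The inequality `k(m+1) ≤ m(k+C+1)+p` would force `k ≤ m(C+1)+p`.
  have h1 := hk (k₀ + m * (C + 1) + p + 1) (by omega)
  have h2 := Nat.mul_le_mul_left (k₀ + m * (C + 1) + p + 1) hsum
  simp only [Finset.card_empty] at h1
  nlinarith

/-- The columns already contribute `km`, leaving room for at most `m(C+1)+p` further parametric
derivatives, whereas a parametric row would supply infinitely many. -/
theorem exists_not_par_of_sum_chimney_eq (hv : v ∈ V.U) (hsum : ∑ i, β i = m) (i : Var m p) :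
    ∃ b, ¬ Par (i, 0, b) := by
  by_contra hall
  push Not at hall
  have htop : ∀ j, β j ≠ ⊤ := fun j h => by
    have := ENat.sum_eq_top.2 ⟨j, Finset.mem_univ j, h⟩
    exact ENat.natCast_ne_top m (hsum ▸ this)
  let l : Var m p → ℕ := fun i => (β i).toNat
  have hl : ∀ i, (l i : ℕ∞) = β i := fun i => ENat.natCast_toNat (htop i)
  have hls : ∑ i, l i = m := by
    have : ((∑ i, l i : ℕ) : ℕ∞) = m := by
      rw [Nat.cast_sum, ← hsum]
      exact Finset.sum_congr rfl fun i _ => hl i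
    exact_mod_cast this
  obtain ⟨C, hC⟩ := D.columns_card_le hind hv (l := l) fun i a b hb => hβ i a b
    ((Nat.cast_lt.2 hb).trans_le (hl i).le)
  let f : ℕ ↪ Der m p := ⟨fun b => (i, 0, l i + b), fun b b' h => by simpa using h⟩
  obtain ⟨k₀, hk⟩ := hC ((Finset.range (m * (C + 1) + p + 1)).map f) (by
    intro υ hυ
    obtain ⟨b, -, rfl⟩ := Finset.mem_map.1 hυ
    exact ⟨hall _, Nat.le_add_right _ _⟩)
  have h1 := hk k₀ le_rfl
  rw [Finset.card_map, Finset.card_range, hls] at h1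
  nlinarith

omit hβ in
-- A parametric row would consist of infinitely many independent functions `δ^b x_i` of bounded
-- order.
theorem exists_not_par_of_integrable (hv : v ∈ V.U) (hint : D.Integrable) (i : Var m p) :
    ∃ b, ¬ Par (i, 0, b) := by
  by_contra hall
  push Not at hall
  have h1 := (le_sup_left.trans_lt hint).ne
  obtain ⟨N, hN⟩ := ENat.ne_top_iff_exists.1 h1
  let f : ℕ ↪ Der m p := ⟨fun b => (i, 0, b), fun b b' h => by simpa using h⟩
  have h2 := D.card_le_of_independent hind
    (T := (Finset.range (m * (N + 1) + p + 1)).map f) (N := N) (fun t ht => by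
      obtain ⟨b, -, rfl⟩ := Finset.mem_map.1 ht
      exact hall b) (fun t ht c hc => by
      obtain ⟨b, -, rfl⟩ := Finset.mem_map.1 ht
      refine ordTau_le_iff.1 ?_ c hc v hv
      rw [hN]
      exact le_iSup₂ (f := fun (i : Var m p) (l : ℕ) =>
        ordTau V.U (D.delta^[l] (fun z => z (Coord.x i)))) i b)
  rw [Finset.card_map, Finset.card_range] at h2
  omega

end Counting

/-! ### Consequences of a zero tunnel number. -/

section Reducing

variable {Par : Der m p → Prop} {r : Der m p → Der m p → Prop}
  (hPar : ∀ υ υ', IsDerOf υ' υ → Par υ' → Par υ)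
  (hred : ∀ υ, D.FunctionOf v {t | Par t ∧ (t = υ ∨ r t υ)} (D.jet υ))
  (htun : ∀ i, ∃ b, ¬ Par (i, 0, b))
include hPar hred htun

/-- Parametric derivatives outside the columns lie in the finite set `X`. Up to a constant, only the
columns are left to generate the `m(k+1)+p` coordinates of order at most `k`. -/
theorem le_sum_chimney (hv : v ∈ V.U) {l : Var m p → ℕ} (hl : ∀ i a b, b < l i → Par (i, a, b))
    (hl' : ∀ i, ∃ a, ¬ Par (i, a, l i)) : m ≤ ∑ i, l i := by
  classical
  choose e he using htun
  choose a ha using hl'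
  let K : ℕ → Set (Der m p) := fun k => {t | Par t ∧ t.2.1 ≤ k}
  have hK : ∀ {k k'}, k ≤ k' → K k ⊆ K k' := fun h t ht => ⟨ht.1, ht.2.trans h⟩
  let X := box a e
  have hX : ∀ υ, Par υ → l υ.1 ≤ υ.2.2 → υ ∈ X := by
    intro υ hυ h
    refine mem_box.2 ⟨?_, ?_⟩
    · by_contra hn
      exact ha υ.1 (hPar (υ.1, a υ.1, l υ.1) υ (isDerOf_iff.2 ⟨rfl, not_lt.1 hn, h⟩) hυ)
    · by_contra hn
      exact he υ.1 (hPar (υ.1, 0, e υ.1) υ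
        (isDerOf_iff.2 ⟨rfl, Nat.zero_le _, not_lt.1 hn⟩) hυ)
  have hjet : ∀ υ, ∃ k, D.FunctionOf v (K k) (D.jet υ) := by
    intro υ
    obtain ⟨g, T, hT, h⟩ := hred υ
    exact ⟨T.sup fun t => t.2.1, g, T,
      fun t ht => ⟨(hT ht).1, Finset.le_sup (f := fun t => t.2.1) ht⟩, h⟩
  choose κ hκ using hjet
  -- `C` bounds the `τ`-order of the parametric derivatives needed for the `x_i` and for `τυ`, `υ ∈
  -- X`. Inside a column `τυ` is again parametric, so from level `C` on, `τ` raises the level by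
  -- one.
  let C := max (X.sup fun υ => κ υ.tau) (Finset.univ.sup fun i : Var m p => κ (i, 0, 0))
  have htau : ∀ k, C ≤ k → ∀ F, D.FunctionOf v (K k) F → D.FunctionOf v (K (k + 1)) (V.tau F) := by
    intro k hk F hF
    refine FunctionOf.vectorField_mem hv hF (hK k.le_succ) fun υ hυ => ?_
    rw [show vectorField V.cartanCoeff (D.jet υ) = D.jet υ.tau from D.tau_jet υ]
    by_cases h : υ.2.2 < l υ.1
    · exact .jet ⟨hl _ _ _ h, Nat.succ_le_succ hυ.2⟩
    · refine (hκ υ.tau).mono (hK ?_)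
      have h1 : κ υ.tau ≤ X.sup fun υ => κ υ.tau :=
        Finset.le_sup (f := fun υ : Der m p => κ υ.tau) (hX υ hυ.1 (not_lt.1 h))
      exact (h1.trans (le_max_left _ _)).trans (hk.trans k.le_succ)
  have hx : ∀ (i : Var m p) (k : ℕ), D.FunctionOf v (K (C + k)) (D.jet (i, k, 0)) := by
    intro i k
    induction k with
    | zero =>
      refine (hκ (i, 0, 0)).mono (hK ?_)
      exact (Finset.le_sup (f := fun i : Var m p => κ (i, 0, 0)) (Finset.mem_univ i)).trans
        (le_max_right _ _)
    | succ k ih =>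
      have := htau _ (Nat.le_add_right _ _) _ ih
      rwa [D.tau_jet] at this
  have hcard : ∀ k, m * (k + 1) + p ≤ (C + k + 1) * ∑ i, l i + X.card := by
    intro k
    have h1 := FunctionOf.span_card_le (D := D) hv (Y := box (fun _ => C + k + 1) l ∪ X) (N := k)
      fun c hc => by
        have hc := mem_coordsLE.1 hc
        have h2 : D.FunctionOf v (K (C + k)) (D.jet c.toDer) := by
          rcases c with ⟨i, k'⟩ | j
          · exact (hx _ k').mono (hK (Nat.add_le_add_left hc C))
          · exact (hx _ 0).mono (hK (by omega))
        rw [D.jet_toDer] at h2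
        refine h2.mono fun υ hυ => ?_
        rw [Finset.mem_coe, Finset.mem_union]
        by_cases h : υ.2.2 < l υ.1
        · exact Or.inl (mem_box.2 ⟨Nat.lt_succ_of_le hυ.2, h⟩)
        · exact Or.inr (hX υ hυ.1 (not_lt.1 h))
    refine h1.trans ((Finset.card_union_le _ _).trans ?_)
    rw [card_box, Finset.mul_sum]
  by_contra hlt
  rw [not_le] at hlt
  -- If `∑ l < m`, the count would give `k + 1 ≤ C ∑ l + |X|` for every `k`.
  have h1 := hcard (C * (∑ i, l i) + X.card)
  have h2 := Nat.mul_le_mul_right (C * (∑ i, l i) + X.card + 1) (Nat.succ_le_of_lt hlt)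
  rw [Nat.succ_mul] at h2
  nlinarith

/-- Well-founded induction. Reducing `δυ`, for `υ` comparable to `υ₀` up to powers of `δ`, produces
only derivatives of the same comparability class or derivatives below `υ₀`. The class is finite and
the latter are covered by induction. -/
theorem exists_delta_stable (hr : IsAdmissible r) (hδ : IsDeltaOrdering r)
    (υ : Der m p) (hυ : Par υ) :
    ∃ K : Finset (Der m p), υ ∈ K ∧ ∀ t ∈ K, Par t ∧ D.FunctionOf v ↑K (D.jet t.delta) := by
  classical
  choose e he using htun
  induction υ using hr.wellFounded.induction with
  | h υ₀ ih =>
  -- The preorder "at most some `δ^b υ'`"; `Cl` is the set of parametric derivatives equivalent to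
  -- `υ₀`.
  let le : Der m p → Der m p → Prop := fun υ υ' =>
    ∃ b : ℕ, υ = Der.delta^[b] υ' ∨ r υ (Der.delta^[b] υ')
  have hiter : ∀ {υ υ'} (b : ℕ), (υ = υ' ∨ r υ υ') →
      (Der.delta^[b] υ = Der.delta^[b] υ' ∨ r (Der.delta^[b] υ) (Der.delta^[b] υ')) := by
    intro υ υ' b h
    rcases h with rfl | h
    · exact Or.inl rfl
    · right
      induction b with
      | zero => exact h
      | succ b ih => simpa only [Function.iterate_succ_apply'] using (hr.delta_iff _ _).2 ih
  have htr : ∀ {a b c : Der m p}, (a = b ∨ r a b) → (b = c ∨ r b c) → (a = c ∨ r a c) := by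
    rintro a b c h1 (rfl | h2)
    exacts [h1, Or.inr (hr.eq_or_rel_trans h1 h2)]
  have le_trans : ∀ {a b c}, le a b → le b c → le a c := by
    rintro a b c ⟨k, hk⟩ ⟨k', hk'⟩
    refine ⟨k + k', ?_⟩
    rw [Function.iterate_add_apply]
    exact htr hk (hiter k hk')
  have le_of : ∀ {a b : Der m p}, (a = b ∨ r a b) → le a b := fun h => ⟨0, h⟩
  let Cl : Set (Der m p) := {υ | Par υ ∧ le υ υ₀ ∧ le υ₀ υ}
  have hfin : Cl.Finite := by
    refine Set.Finite.of_finite_image (f := fun υ => (υ.1, 0, υ.2.2))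
      ((box (fun _ => 1) e).finite_toSet.subset ?_) ?_
    · rintro _ ⟨υ, hυ, rfl⟩
      refine Finset.mem_coe.2 (mem_box.2 ⟨Nat.one_pos, ?_⟩)
      by_contra hn
      exact he υ.1 (hPar (υ.1, 0, e υ.1) υ
        (isDerOf_iff.2 ⟨rfl, Nat.zero_le _, not_lt.1 hn⟩) hυ.1)
    -- In a `δ`-ordering no `δ^k τ^a δ^b x_j` reaches `τ^a' δ^b x_j` when `a < a'`. So each pair
    -- `(j, b)` occurs at most once in the class, and `b` is bounded because the tunnel number is
    -- `0`.
    · have key : ∀ j a a' b, (j, a, b) ∈ Cl → (j, a', b) ∈ Cl → ¬ a < a' := by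
        intro j a a' b h h' hlt
        obtain ⟨k, hk⟩ := le_trans h'.2.1 h.2.2
        have h1 : Der.delta^[k] ((j, a, b) : Der m p) = (j, a, b + k) :=
          tau_iterate_delta_iterate 0 k (j, a, b)
        rw [h1] at hk
        have h2 := hδ.lex j a (b + k) a' b (Or.inl hlt)
        exact hr.irrefl _ (hr.eq_or_rel_trans hk h2)
      rintro ⟨j, a, b⟩ h ⟨j', a', b'⟩ h' heq
      simp only [Prod.mk.injEq, true_and] at heq
      obtain ⟨rfl, rfl⟩ := heq
      rcases lt_trichotomy a a' with h1 | rfl | h1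
      exacts [absurd h1 (key _ _ _ _ h h'), rfl, absurd h1 (key _ _ _ _ h' h)]
  choose! K hKmem hK using ih
  choose g T hT hg hgT using hred
  have hTcl : ∀ υ ∈ Cl, ∀ t ∈ T υ.delta, t ∈ Cl ∨ r t υ₀ := by
    intro υ hυ t ht
    have h1 := hT υ.delta ht
    by_cases h : le υ₀ t
    · refine Or.inl ⟨h1.1, le_trans (le_trans (le_of h1.2) ?_) hυ.2.1, h⟩
      exact ⟨1, Or.inl rfl⟩
    · refine Or.inr ?_
      rcases hr.trichotomy t υ₀ with h2 | h2 | h2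
      · exact h2
      · exact absurd (le_of (Or.inl h2.symm)) h
      · exact absurd (le_of (Or.inr h2)) h
  let L : Finset (Der m p) := (hfin.toFinset.biUnion fun υ => T υ.delta).filter fun t => r t υ₀
  have hL : ∀ t ∈ L, r t υ₀ ∧ Par t := by
    intro t ht
    obtain ⟨h1, h2⟩ := Finset.mem_filter.1 ht
    obtain ⟨υ, -, h3⟩ := Finset.mem_biUnion.1 h1
    exact ⟨h2, (hT _ h3).1⟩
  refine ⟨hfin.toFinset ∪ L.biUnion K, ?_, fun t ht => ?_⟩
  · exact Finset.mem_union_left _ (hfin.mem_toFinset.2 ⟨hυ, le_of (Or.inl rfl), le_of (Or.inl rfl)⟩)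
  rcases Finset.mem_union.1 ht with ht | ht
  · have htC := hfin.mem_toFinset.1 ht
    refine ⟨htC.1, g t.delta, T t.delta, fun s hs => ?_, hg _, hgT _⟩
    rcases hTcl t htC s hs with h | h
    · exact Finset.mem_coe.2 (Finset.mem_union_left _ (hfin.mem_toFinset.2 h))
    · have hsL : s ∈ L := Finset.mem_filter.2 ⟨Finset.mem_biUnion.2 ⟨t, ht, hs⟩, h⟩
      exact Finset.mem_coe.2 (Finset.mem_union_right _ (Finset.mem_biUnion.2
        ⟨s, hsL, hKmem s (hL s hsL).1 (hL s hsL).2⟩))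
  · obtain ⟨s, hs, hts⟩ := Finset.mem_biUnion.1 ht
    have h1 := hK s (hL s hs).1 (hL s hs).2 t hts
    refine ⟨h1.1, h1.2.mono ?_⟩
    exact Finset.coe_subset.2 ((Finset.subset_biUnion_of_mem K hs).trans Finset.subset_union_right)

/-- All `δ^l F` are functions of one finite `δ`-stable set of jets near `v`, which bounds their
orders there; the identity theorem carries the vanishing of the higher partial derivatives to all of
`U`. -/
theorem exists_ordTau_le (hv : v ∈ V.U) (hr : IsAdmissible r) (hδ : IsDeltaOrdering r)
    (υ : Der m p) : ∃ N : ℕ, ∀ F, IsFunctionOn V.U F → F =ᶠ[𝓝 v] D.jet υ → ∀ l,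
      ordTau V.U (D.delta^[l] F) ≤ N := by
  classical
  have hst := D.exists_delta_stable hPar hred htun hr hδ
  choose! K hKmem hK using hst
  obtain ⟨g, T, hT, hg, e⟩ := hred υ
  have hKS : ∀ t ∈ T.biUnion K, D.FunctionOf v ↑(T.biUnion K) (D.jet t.delta) := by
    intro t ht
    obtain ⟨s, hs, hts⟩ := Finset.mem_biUnion.1 ht
    exact (hK s (hT hs).1 t hts).2.mono (Finset.coe_subset.2 (Finset.subset_biUnion_of_mem K hs))
  have hF0 : D.FunctionOf v ↑(T.biUnion K) (D.jet υ) :=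
    ⟨g, T, fun t ht => Finset.mem_coe.2 (Finset.mem_biUnion.2 ⟨t, ht, hKmem t (hT ht).1⟩), hg, e⟩
  choose N hN using fun t => (D.isGermAt_jet hv t).exists_coordsLE
  refine ⟨(T.biUnion K).sup N, fun F hF hFe l => ordTau_le_iff.2 fun c hc => ?_⟩
  have h1 : D.FunctionOf v ↑(T.biUnion K) (D.delta^[l] F) := by
    induction l with
    | zero => exact hF0.congr hFe.symm
    | succ l ih =>
      rw [Function.iterate_succ_apply']
      refine FunctionOf.vectorField_mem hv ih subset_rfl fun t ht => (hKS t ht).congr ?_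
      filter_upwards [V.isOpen.mem_nhds hv] with z hz using (D.delta_jet t hz).symm
  have h2 := h1.analyticNear hv (S := coordsLE m p ((T.biUnion K).sup N)) fun t ht =>
    (hN t).mono (coordsLE_mono (Finset.le_sup ht))
  have h3 := IsFunctionOn.eventuallyEq_zero V.isConnected.isPreconnected
    ((hF.delta_iterate D l).pderiv c) hv (by
      filter_upwards [h2.eventually] with z hz
      exact hz.pderiv_eq_zero fun h => absurd (mem_coordsLE.1 h) (not_le.2 hc))
  exact fun z hz => (h3 z hz).self_of_nhds

theorem integrable_of_tunnel (hv : v ∈ V.U) (hr : IsAdmissible r) (hδ : IsDeltaOrdering r) :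
    D.Integrable := by
  choose N hN using D.exists_ordTau_le hPar hred htun hv hr hδ
  have hx : ∀ (i : Var m p) l, ordTau V.U (D.delta^[l] fun z => z (Coord.x i)) ≤ N (i, 0, 0) :=
    fun i => hN (i, 0, 0) _ (isFunctionOn_coord _) .rfl
  have hu : ∀ (k : Fin m) l, ordTau V.U (D.delta^[l] fun z => z (Coord.u k)) ≤
      N (Sum.inl k, 1, 0) := fun k => hN (Sum.inl k, 1, 0) _ (isFunctionOn_coord _)
        (.of_eq (D.jet_toDer (Sum.inl (k, 1))).symm)
  refine (sup_le (iSup₂_le fun i l => (hx i l).trans ?_)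
    (iSup₂_le fun k l => (hu k l).trans ?_)).trans_lt
    (ENat.natCast_lt_top (max (Finset.univ.sup fun i : Var m p => N (i, 0, 0))
      (Finset.univ.sup fun k : Fin m => N (Sum.inl k, 1, 0))))
  · exact Nat.cast_le.2 ((Finset.le_sup (f := fun i : Var m p => N (i, 0, 0))
      (Finset.mem_univ i)).trans (le_max_left _ _))
  · exact Nat.cast_le.2 ((Finset.le_sup (f := fun k : Fin m => N (Sum.inl k, 1, 0))
      (Finset.mem_univ k)).trans (le_max_right _ _))

end Reducing

end Symmetry

end

end Diff

end

/-! ### The theorem. -/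

theorem mainTheorem3 {m p : ℕ} (V : Diff.OrdDiffiety m p) (D : Diff.Symmetry V)
    (v : Diff.Coord m p → ℝ) (hv : v ∈ V.U)
    (r : Diff.Der m p → Diff.Der m p → Prop) (hr : Diff.IsAdmissible r)
    (A : List ((Diff.Der m p → ℝ) → ℝ))
    (hA : Diff.IsCharSet (D.point v) r (D.InIdeal v) A)
    (hsolved : Diff.IsSolved (D.point v) r A) :
    Diff.chimneyNumber (D.point v) r A ≤ (m : ℕ∞) ∧
    (Diff.IsDeltaOrdering r →
      [D.Integrable,
        Diff.tunnelNumber (D.point v) r A = 0,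
        Diff.chimneyNumber (D.point v) r A = (m : ℕ∞)].TFAE) := by
  obtain ⟨ρ, hch, hmin⟩ := hA
  have hmain : ∀ υ, (∃ P ∈ A, Diff.IsMain (D.point v) r P υ) ↔ ∃ s ∈ ρ, s.1 = υ := by
    intro υ
    constructor
    · rintro ⟨P, hP, hυ⟩
      obtain ⟨s, hs, h, -⟩ := Diff.exists_of_forall₂_left hch.2.1 hP
      exact ⟨s, hs, hr.isMain_unique h.1 hυ⟩
    · rintro ⟨s, hs, rfl⟩
      obtain ⟨P, hP, h, -⟩ := Diff.exists_of_forall₂_right hch.2.1 hs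
      exact ⟨P, hP, h.1⟩
  have hind : ∀ (T : Finset (Diff.Der m p)) (g : Diff.Der m p → ℝ),
      (∀ t ∈ T, Diff.IsParametric ρ t) →
      (∀ c, ∑ υ ∈ T, g υ * Diff.pderiv c (D.jet υ) v = 0) → ∀ υ ∈ T, g υ = 0 :=
    fun T g hT hg => D.parametric_independent hv hr hch hmin hsolved hT hg
  have hPar : ∀ υ υ' : Diff.Der m p, Diff.IsDerOf υ' υ → Diff.IsParametric ρ υ' →
      Diff.IsParametric ρ υ := fun υ υ' h h' => .of_isDerOf h h'
  have hred : ∀ υ, D.FunctionOf v {t | Diff.IsParametric ρ t ∧ (t = υ ∨ r t υ)} (D.jet υ) := by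
    intro υ
    obtain ⟨R, T, hT, hR, hI⟩ := D.exists_reduction hr hch hsolved hv υ
    refine ⟨R, T, fun t ht => hT t ht, hR, ?_⟩
    filter_upwards [(hI.vanish D hv).2] with z hz
    exact sub_eq_zero.1 hz
  let β : Diff.Var m p → ℕ∞ := fun i =>
    ⨅ (b : ℕ) (_ : ∃ P ∈ A, ∃ a, Diff.IsMain (D.point v) r P (i, a, b)), (b : ℕ∞)
  -- A main derivative dividing `τ^a δ^b x_i` would have `δ`-exponent at most `b`, hence below `β
  -- i`.
  have hβ : ∀ i a (b : ℕ), (b : ℕ∞) < β i → Diff.IsParametric ρ (i, a, b) := by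
    intro i a b hb s hs hder
    obtain ⟨P, hP, h⟩ := (hmain s.1).2 ⟨s, hs, rfl⟩
    obtain ⟨h1, h2, h3⟩ := Diff.isDerOf_iff.1 hder
    have h4 : β i ≤ (s.1.2.2 : ℕ) := Diff.iInf_natCast_le ⟨P, hP, s.1.2.1, by
      rw [show ((i, s.1.2.1, s.1.2.2) : Diff.Der m p) = s.1 from
        Prod.ext h1.symm rfl]; exact h⟩
    exact absurd (hb.trans_le h4) (not_lt.2 (Nat.cast_le.2 h3))
  have hβ' : ∀ i, β i ≠ ⊤ → ∃ a, ¬ Diff.IsParametric ρ (i, a, (β i).toNat) := by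
    intro i hi
    obtain ⟨b, ⟨P, hP, a, h⟩, hb⟩ := Diff.exists_of_iInf_natCast_ne_top hi
    obtain ⟨s, hs, h1⟩ := (hmain _).1 ⟨P, hP, h⟩
    refine ⟨a, fun hpar => hpar s hs ?_⟩
    rw [show β i = b from hb, ENat.toNat_natCast, h1]
    exact .refl _
  -- Only a main derivative with no `τ` can have a `δ^b x_i` among its derivatives, so `α_i = 0`
  -- means that the row of `x_i` is not wholly parametric.
  have htunnel : Diff.tunnelNumber (D.point v) r A = 0 ↔
      ∀ i, ∃ b, ¬ Diff.IsParametric ρ (i, 0, b) := by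
    rw [Diff.tunnelNumber, Finset.sum_eq_zero_iff]
    refine ⟨fun h i => ?_, fun h i _ => ?_⟩
    · have h0 := h i (Finset.mem_univ i)
      obtain ⟨a, ⟨P, hP, b, hm⟩, ha⟩ := Diff.exists_of_iInf_natCast_ne_top
        (by rw [h0]; exact ENat.zero_ne_top)
      rw [h0] at ha
      obtain rfl : a = 0 := by exact_mod_cast ha.symm
      obtain ⟨s, hs, h1⟩ := (hmain _).1 ⟨P, hP, hm⟩
      exact ⟨b, fun hpar => hpar s hs (h1 ▸ .refl _)⟩
    · obtain ⟨b, hb⟩ := h i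
      simp only [Diff.IsParametric, not_forall, not_not] at hb
      obtain ⟨s, hs, hder⟩ := hb
      obtain ⟨P, hP, hm⟩ := (hmain s.1).2 ⟨s, hs, rfl⟩
      obtain ⟨h1, h2, h3⟩ := Diff.isDerOf_iff.1 hder
      have h4 : s.1 = (i, 0, s.1.2.2) := by
        rw [← show s.1.1 = i from h1, ← Nat.le_zero.1 h2]
      rw [h4] at hm
      have := Diff.iInf_natCast_le (q := fun a => ∃ P ∈ A, ∃ b,
        Diff.IsMain (D.point v) r P (i, a, b)) ⟨P, hP, _, hm⟩
      exact le_antisymm (this.trans (by simp)) (zero_le)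
  have hle : ∑ i, β i ≤ m := D.sum_chimney_le hind hβ hv
  refine ⟨hle, fun hδ => ?_⟩
  tfae_have 1 → 2 := fun hint => htunnel.2 (D.exists_not_par_of_integrable hind hv hint)
  tfae_have 2 → 1 := fun h => D.integrable_of_tunnel hPar hred (htunnel.1 h) hv hr hδ
  tfae_have 3 → 2 := fun h => htunnel.2 (D.exists_not_par_of_sum_chimney_eq hind hβ hv h)
  tfae_have 2 → 3 := by
    intro h
    have htop : ∀ i, β i ≠ ⊤ := fun i hi =>
      (ENat.natCast_ne_top m) (top_le_iff.1
        ((ENat.sum_eq_top.2 ⟨i, Finset.mem_univ i, hi⟩).ge.trans hle))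
    have hl : ∀ i, ((β i).toNat : ℕ∞) = β i := fun i => ENat.natCast_toNat (htop i)
    have h1 := D.le_sum_chimney hPar hred (htunnel.1 h) hv (l := fun i => (β i).toNat)
      (fun i a b hb => hβ i a b ((Nat.cast_lt.2 hb).trans_le (hl i).le)) fun i => hβ' i (htop i)
    refine le_antisymm hle ?_
    calc (m : ℕ∞) ≤ ((∑ i, (β i).toNat : ℕ) : ℕ∞) := Nat.cast_le.2 h1
      _ = ∑ i, β i := by rw [Nat.cast_sum]; exact Finset.sum_congr rfl fun i _ => hl i
  tfae_finish
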